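/- Let $\overline{S_3}(n)$ denote the number of $3$-Schur overpartitions of $n$, defined by the identity of formal power series $$\sum_{n\ge 0}\overline{S_3}(n)q^n=\prod_{n\ge 1}\frac{(1+q^{2n-1})(1-q^{3(2n-1)})}{(1+q^{3(2n-1)})(1-q^{2n-1})}.$$ For all integers $n\ge 0$ and $\alpha\ge 0$: $$\overline{S_3}(2^\alpha\cdot 2n)\equiv\overline{S_3}(2n)\pmod 4,$$ $$\overline{S_3}(3^\alpha(2n+1))\equiv\overline{S_3}(2n+1)\pmod 4,$$ $$\overline{S_3}(32n+20)\equiv 0\pmod 4,$$ $$\overline{S_3}(96n+16j+12)\equiv 0\pmod 4\quad\text{for each } j\in\{1,2,3,4,5\},$$ $$\overline{S_3}(3^\alpha(12n+6))\equiv(-1)^\alpha\,\overline{S_3}(12n+6)\pmod 9,$$ $$\overline{S_3}(3^\alpha(12n+6))\equiv\overline{S_3}(12n+6)\pmod{12},$$ $$\overline{S_3}(144n+24i+18)\equiv 0\pmod{12}\quad\text{for each } i\in\{1,2,3,4,5\},$$ $$\overline{S_3}(48n+30)\equiv 0\pmod{12},$$ $$\overline{S_3}(48n+42)\equiv 0\pmod{12},$$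 $$\overline{S_3}(48n+46)\equiv 0\pmod{16},$$ $$\overline{S_3}(24n+22)\equiv 0\pmod{24}.$$ -/

import Mathlib

/-- The `k`-th factor (`k = 0, 1, 2, …`, with `m = 2k + 1` the `k`-th odd positive integer)
`((1 + q^m) (1 - q^(t m))) / ((1 + q^(t m)) (1 - q^m))`, as a formal power series in `q` over `ℤ`.
For `t ≥ 1` the denominator has constant coefficient `1`, so `PowerSeries.invOfUnit _ 1` is its
inverse; see `schurOverFactor_mul`. -/
noncomputable def schurOverFactor (t k : ℕ) : PowerSeries ℤ :=
  ((1 + PowerSeries.X ^ (2 * k + 1)) * (1 - PowerSeries.X ^ (t * (2 * k + 1)))) *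
    PowerSeries.invOfUnit
      ((1 + PowerSeries.X ^ (t * (2 * k + 1))) * (1 - PowerSeries.X ^ (2 * k + 1))) 1

open scoped PowerSeries.WithPiTopology in
/-- The infinite product of the factors `schurOverFactor t k`, `k ≥ 0`, in `ℤ⟦q⟧` with the topology
of coefficientwise convergence (`ℤ` discrete). It converges for `t ≥ 1`; see
`multipliable_schurOverFactor`. -/
noncomputable def schurOverGenFun (t : ℕ) : PowerSeries ℤ :=
  ∏' k : ℕ, schurOverFactor t k

/-- The number of `t`-Schur overpartitions of `n` (for odd `t ≥ 3`), defined by its generating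
function. -/
noncomputable def schurOver (t n : ℕ) : ℤ :=
  PowerSeries.coeff n (schurOverGenFun t)

/-- The factor is the quotient it is meant to be. -/
theorem schurOverFactor_mul {t : ℕ} (ht : 1 ≤ t) (k : ℕ) :
    schurOverFactor t k *
        ((1 + PowerSeries.X ^ (t * (2 * k + 1))) * (1 - PowerSeries.X ^ (2 * k + 1))) =
      (1 + PowerSeries.X ^ (2 * k + 1)) * (1 - PowerSeries.X ^ (t * (2 * k + 1))) := by
  have h0 : t * (2 * k + 1) ≠ 0 := by positivity
  unfold schurOverFactor
  rw [mul_assoc, PowerSeries.invOfUnit_mul _ _ (by simp [h0]), mul_one]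

open scoped PowerSeries.WithPiTopology in
/-- The infinite product converges. -/
theorem multipliable_schurOverFactor {t : ℕ} (ht : 1 ≤ t) :
    Multipliable (schurOverFactor t) := by
  have key : ∀ k : ℕ, ((2 * k + 1 : ℕ) : ℕ∞) ≤ (schurOverFactor t k - 1).order := by
    intro k
    have h0 : t * (2 * k + 1) ≠ 0 := by positivity
    have hu := PowerSeries.mul_invOfUnit
      ((1 + PowerSeries.X ^ (t * (2 * k + 1))) * (1 - PowerSeries.X ^ (2 * k + 1)) :
        PowerSeries ℤ) 1 (by simp [h0])
    refine PowerSeries.nat_le_order _ _ (PowerSeries.X_pow_dvd_iff.mp ?_)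
    obtain ⟨s, rfl⟩ : ∃ s, t = s + 1 := ⟨t - 1, by omega⟩
    refine ⟨(2 - 2 * PowerSeries.X ^ (s * (2 * k + 1))) * PowerSeries.invOfUnit
      ((1 + PowerSeries.X ^ ((s + 1) * (2 * k + 1))) * (1 - PowerSeries.X ^ (2 * k + 1))) 1, ?_⟩
    unfold schurOverFactor
    generalize PowerSeries.invOfUnit (_ : PowerSeries ℤ) 1 = I at hu ⊢
    have e : (PowerSeries.X : PowerSeries ℤ) ^ ((s + 1) * (2 * k + 1)) =
      PowerSeries.X ^ (s * (2 * k + 1)) * PowerSeries.X ^ (2 * k + 1) := by ring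
    linear_combination hu - 2 * I * e
  have h := PowerSeries.WithPiTopology.multipliable_one_add_of_tendsto_order_atTop_nhds_top
    (f := fun k => schurOverFactor t k - 1) (R := ℤ) (by
      rw [ENat.tendsto_nhds_top_iff_natCast_lt]
      intro n
      filter_upwards [Filter.eventually_ge_atTop n] with k hk
      refine lt_of_lt_of_le ?_ (key k)
      exact_mod_cast (by omega : n < 2 * k + 1))
  simpa using h

/-
With `φ(q) = ∑ q^(n²)` over `n ∈ ℤ` and `t = 3`, the triple product gives the generating function
`φ(q) φ(-q³) / (φ(-q²) φ(-q⁶))`. Modulo `4`, `φ(-q) ≡ φ(q)` and `φ(q)² ≡ 1`, so it is congruent to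
`φ(q) φ(q²) φ(q³) φ(q⁶) ≡ φ(q) + φ(q²) + φ(q³) + φ(q⁶) - 3`: the congruences modulo `4` are
statements about representations by `m²`, `2m²`, `3m²` and `6m²`.

With `ψ(q) = ∑ q^(n(n + 1)/2)` over `n ≥ 0`, dissections and
`φ(q) φ(q³) - φ(-q) φ(-q³) = 4 q ψ(q²) ψ(q⁶)` yield
`∑ S(4n + 2) qⁿ = 2 ψ(q) ψ(q³) / (φ(-q) φ(-q³))`. In its `3`-dissection,
`∑ S(12n + 6) qⁿ ≡ 6 ψ(q) φ(-q) ψ(q³) φ(-q³)` modulo `9`, an eta quotient that extracting the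
exponents `3n + 1` turns into its negative, while `∑ S(12n + 10) qⁿ` is `12` times a series that
modulo `2`, and after extracting the odd exponents also modulo `4`, is a series in `q²`.
-/

open Filter PowerSeries
open scoped Topology PowerSeries.WithPiTopology

section Triangular

/-- The triangular number `k (k + 1) / 2` of an integer; as a natural number, so that it can be an
exponent. -/
def triangular (k : ℤ) : ℕ := (k * (k + 1) / 2).toNat

theorem two_mul_triangular (k : ℤ) : 2 * (triangular k : ℤ) = k * (k + 1) := by
  have nonneg : 0 ≤ k * (k + 1) := by
    rcases le_or_gt 0 k with h | h
    · positivity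
    · nlinarith
  have even : 2 ∣ k * (k + 1) := (Int.even_mul_succ_self k).two_dvd
  unfold triangular
  omega

theorem triangular_add_one (k : ℤ) : (triangular (k + 1) : ℤ) = triangular k + (k + 1) := by
  linarith [two_mul_triangular k, two_mul_triangular (k + 1)]

theorem triangular_neg (k : ℤ) : (triangular (-k) : ℤ) = triangular k - k := by
  linarith [two_mul_triangular k, two_mul_triangular (-k)]

theorem triangular_add_triangular_neg (j : ℤ) :
    triangular j + triangular (-j) = j.natAbs ^ 2 := by
  zify
  rw [sq_abs]
  linarith [two_mul_triangular j, two_mul_triangular (-j)]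

theorem triangular_neg_natCast (n : ℕ) : triangular (-n) = n.choose 2 := by
  induction n with
  | zero => rfl
  | succ n ih =>
    have h1 := triangular_add_one n
    have h2 := triangular_neg n
    have h3 := triangular_neg (n + 1)
    rw [Nat.choose_succ_succ' n 1, Nat.choose_one_right, ← ih, Nat.cast_succ]
    omega

theorem natAbs_le_triangular_add_one (k : ℤ) : k.natAbs ≤ triangular k + 1 := by
  have := two_mul_triangular k
  zify
  rcases abs_cases k with ⟨h, _⟩ | ⟨h, _⟩ <;> rw [h] <;> nlinarith

theorem natAbs_le_theta_exponent {u v : ℕ} (huv : 0 < u + v) (k : ℤ) :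
    k.natAbs ≤ u * triangular k + v * triangular (-k) + 1 := by
  rcases (by omega : 0 < u ∨ 0 < v) with h | h
  · have := natAbs_le_triangular_add_one k
    have := Nat.le_mul_of_pos_left (triangular k) h
    omega
  · have := natAbs_le_triangular_add_one (-k)
    have := Nat.le_mul_of_pos_left (triangular (-k)) h
    omega

end Triangular

section GaussBinom

variable {R : Type*} [CommRing R]

/-- The Gaussian binomial coefficient with base `Q`, defined by the `Q`-Pascal rule. -/
def gaussBinom (Q : R) : ℕ → ℕ → R
  | _, 0 => 1
  | 0, _ + 1 => 0
  | n + 1, k + 1 => gaussBinom Q n k + Q ^ (k + 1) * gaussBinom Q n (k + 1)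

theorem gaussBinom_zero_right (Q : R) (n : ℕ) : gaussBinom Q n 0 = 1 := by
  rw [gaussBinom]

theorem gaussBinom_succ_succ (Q : R) (n k : ℕ) :
    gaussBinom Q (n + 1) (k + 1) = gaussBinom Q n k + Q ^ (k + 1) * gaussBinom Q n (k + 1) := by
  rw [gaussBinom]

theorem gaussBinom_eq_zero_of_lt (Q : R) {n k : ℕ} (h : n < k) : gaussBinom Q n k = 0 := by
  induction n generalizing k with
  | zero => obtain ⟨k, rfl⟩ := Nat.exists_eq_add_of_lt h; rw [zero_add, gaussBinom]
  | succ n ih =>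
    obtain ⟨k, rfl⟩ := Nat.exists_eq_add_one_of_ne_zero (Nat.ne_zero_of_lt h)
    rw [gaussBinom_succ_succ, ih (by omega), ih (by omega), mul_zero, add_zero]

theorem gaussBinom_self (Q : R) (n : ℕ) : gaussBinom Q n n = 1 := by
  induction n with
  | zero => exact gaussBinom_zero_right Q 0
  | succ n ih => simp [gaussBinom_succ_succ, ih, gaussBinom_eq_zero_of_lt Q (Nat.lt_succ_self n)]

theorem gaussBinom_add_mul_prod (Q : R) (m k : ℕ) :
    gaussBinom Q (m + k) k * ((∏ i ∈ Finset.range m, (1 - Q ^ (i + 1))) *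
      ∏ i ∈ Finset.range k, (1 - Q ^ (i + 1))) = ∏ i ∈ Finset.range (m + k), (1 - Q ^ (i + 1)) := by
  induction m generalizing k with
  | zero => simp [gaussBinom_self]
  | succ m ihm =>
    induction k with
    | zero => simp [gaussBinom_zero_right]
    | succ k ihk =>
      have h1 := ihm (k + 1)
      rw [show m + 1 + (k + 1) = m + 1 + k + 1 by ring, gaussBinom_succ_succ,
        Finset.prod_range_succ _ (m + 1 + k), ← ihk]
      rw [show m + (k + 1) = m + 1 + k by ring, ← ihk] at h1
      rw [Finset.prod_range_succ _ k] at h1 ⊢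
      rw [Finset.prod_range_succ _ m] at h1 ⊢
      have hpow : Q ^ (m + 1 + k + 1) = Q ^ (k + 1) * Q ^ (m + 1) := by ring
      rw [hpow]
      linear_combination Q ^ (k + 1) * (1 - Q ^ (m + 1)) * h1

theorem sum_gaussBinom_succ_mul (Q : R) (n : ℕ) (x : ℕ → R) :
    ∑ j ∈ Finset.range (n + 1 + 1), gaussBinom Q (n + 1) j * x j =
      ∑ j ∈ Finset.range (n + 1), gaussBinom Q n j * x (j + 1) +
        ∑ j ∈ Finset.range (n + 1), gaussBinom Q n j * (Q ^ j * x j) := by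
  have drop_last :=
    Finset.sum_range_succ (fun j => gaussBinom Q n (j + 1) * (Q ^ (j + 1) * x (j + 1))) n
  rw [gaussBinom_eq_zero_of_lt Q n.lt_succ_self, zero_mul, add_zero] at drop_last
  rw [Finset.sum_range_succ', Finset.sum_range_succ' (fun j => gaussBinom Q n j * (Q ^ j * x j)),
    ← drop_last, ← add_assoc, ← Finset.sum_add_distrib, gaussBinom_zero_right,
    gaussBinom_zero_right, pow_zero, one_mul, one_mul]
  refine congrArg (· + x 0) (Finset.sum_congr rfl fun j _ => ?_)
  rw [gaussBinom_succ_succ]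
  ring

theorem prod_one_add_mul_pow_eq_sum_gaussBinom (Q a : R) (n : ℕ) :
    ∏ i ∈ Finset.range n, (1 + a * Q ^ i) =
      ∑ k ∈ Finset.range (n + 1), gaussBinom Q n k * (Q ^ k.choose 2 * a ^ k) := by
  induction n generalizing a with
  | zero => simp [gaussBinom_zero_right]
  | succ n ih =>
    have shift (i : ℕ) : 1 + a * Q ^ (i + 1) = 1 + a * Q * Q ^ i := by ring
    rw [Finset.prod_range_succ', sum_gaussBinom_succ_mul]
    simp only [shift, ih, pow_zero, mul_one, mul_add, Finset.sum_mul]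
    rw [add_comm]
    congr 1 <;> refine Finset.sum_congr rfl fun k _ => ?_
    · rw [Nat.choose_succ_succ' k 1, Nat.choose_one_right]
      ring
    · ring

theorem theta_term_step (a b : R) {N : ℕ} {k : ℤ} (hk : -(N + 1 : ℤ) ≤ k) :
    b * (a * b) ^ N * (a ^ triangular (k + 1) * b ^ triangular (-(k + 1))) =
      (a * b) ^ (N + 1 + k).toNat * (a ^ triangular k * b ^ triangular (-k)) := by
  have ha : N + triangular (k + 1) = (N + 1 + k).toNat + triangular k := by
    have := triangular_add_one k
    omega
  have hb : 1 + N + triangular (-(k + 1)) = (N + 1 + k).toNat + triangular (-k) := by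
    have := triangular_add_one k
    have := triangular_neg k
    have := triangular_neg (k + 1)
    omega
  calc _ = a ^ (N + triangular (k + 1)) * b ^ (1 + N + triangular (-(k + 1))) := by ring
    _ = _ := by rw [ha, hb]; ring

theorem prod_mul_prod_eq_sum_gaussBinom (a b : R) (M N : ℕ) :
    (∏ i ∈ Finset.range M, (1 + a * (a * b) ^ i)) * ∏ i ∈ Finset.range N, (1 + b * (a * b) ^ i) =
      ∑ j ∈ Finset.range (M + N + 1), gaussBinom (a * b) (M + N) j *
        (a ^ triangular (j - N) * b ^ triangular (-(j - N))) := by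
  induction N with
  | zero =>
    rw [Finset.prod_range_zero, mul_one, prod_one_add_mul_pow_eq_sum_gaussBinom]
    refine Finset.sum_congr rfl fun j _ => ?_
    have hb := triangular_neg_natCast j
    have ha : triangular j = j.choose 2 + j := by
      have := triangular_neg j
      omega
    simp only [Nat.cast_zero, sub_zero, add_zero, ha, hb]
    ring
  | succ N ih =>
    have shift (j : ℕ) : ((j + 1 : ℕ) : ℤ) - ↑(N + 1) = j - N := by
      push_cast
      ring
    have step (j : ℕ) : (a * b) ^ j * (a ^ triangular (j - ↑(N + 1)) *
        b ^ triangular (-(j - ↑(N + 1)))) =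
          b * (a * b) ^ N * (a ^ triangular (j - N) * b ^ triangular (-(j - N))) := by
      have := theta_term_step a b (N := N) (k := j - ↑(N + 1)) (by omega)
      rw [← shift, Nat.cast_succ j, add_sub_right_comm, this]
      congr
      omega
    rw [Finset.prod_range_succ, ← mul_assoc, ih, ← add_assoc, sum_gaussBinom_succ_mul, mul_one_add,
      Finset.sum_mul]
    simp only [shift, step]
    refine congrArg _ (Finset.sum_congr rfl fun j _ => ?_)
    ring

theorem prod_mul_prod_eq_sum_Icc_gaussBinom (a b : R) (N : ℕ) :
    (∏ i ∈ Finset.range N, (1 + a * (a * b) ^ i)) * ∏ i ∈ Finset.range N, (1 + b * (a * b) ^ i) =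
      ∑ k ∈ Finset.Icc (-N : ℤ) N, gaussBinom (a * b) (N + N) (N + k).toNat *
        (a ^ triangular k * b ^ triangular (-k)) := by
  rw [prod_mul_prod_eq_sum_gaussBinom]
  refine Finset.sum_nbij' (fun j => (j : ℤ) - N) (fun k => (N + k).toNat) ?_ ?_ ?_ ?_ ?_
  · intro j hj; rw [Finset.mem_range] at hj; rw [Finset.mem_Icc]; omega
  · intro k hk; rw [Finset.mem_Icc] at hk; rw [Finset.mem_range]; omega
  · intro j _; omega
  · intro k hk; rw [Finset.mem_Icc] at hk; omega
  · intro j _; rw [add_sub_cancel, Int.toNat_natCast]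

end GaussBinom

section Convergence

theorem X_pow_dvd_monomial {R : Type*} [CommRing R] {n e : ℕ} (h : n ≤ e) (c : R) :
    X ^ n ∣ monomial e c := by
  rw [monomial_eq_C_mul_X_pow]
  exact dvd_mul_of_dvd_right (pow_dvd_pow X h) _

variable {R : Type*} [CommRing R] [TopologicalSpace R] {ι : Type*}

theorem summable_of_finite_not_X_pow_dvd {f : ι → PowerSeries R}
    (hf : ∀ n, {i | ¬ X ^ n ∣ f i}.Finite) : Summable f := by
  rw [WithPiTopology.summable_iff_summable_coeff]
  exact fun n => summable_of_hasFiniteSupport <| (hf (n + 1)).subset fun i hi hdvd =>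
    hi (X_pow_dvd_iff.mp hdvd n n.lt_succ_self)

theorem multipliable_one_add_of_X_pow_dvd [IsTopologicalRing R] {f : ℕ → PowerSeries R}
    (hf : ∀ n, X ^ n ∣ f n) : Multipliable fun n => 1 + f n := by
  refine WithPiTopology.multipliable_one_add_of_tendsto_order_atTop_nhds_top R ?_
  rw [ENat.tendsto_nhds_top_iff_natCast_lt]
  intro n
  filter_upwards [eventually_ge_atTop (n + 1)] with k hk
  exact (Nat.cast_lt.mpr hk).trans_le (nat_le_order _ _ (X_pow_dvd_iff.mp (hf k)))

theorem tendsto_sum_mul_of_finite_not_X_pow_dvd [IsTopologicalRing R] [T2Space R]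
    {x : ι → PowerSeries R} (hx : ∀ n, {i | ¬ X ^ n ∣ x i}.Finite) {s : ℕ → Finset ι}
    (hs : Tendsto s atTop atTop) {c : ℕ → ι → PowerSeries R} {c₀ : PowerSeries R}
    (hc : ∀ i, Tendsto (fun N => c N i) atTop (𝓝 c₀)) :
    Tendsto (fun N => ∑ i ∈ s N, c N i * x i) atTop (𝓝 (c₀ * ∑' i, x i)) := by
  rw [WithPiTopology.tendsto_iff_coeff_tendsto]
  intro n
  let F : Finset ι := (hx (n + 1)).toFinset
  have small (d : PowerSeries R) {i : ι} (hi : i ∉ F) : coeff n (d * x i) = 0 := by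
    have hdvd : X ^ (n + 1) ∣ x i := by simpa [F] using hi
    exact X_pow_dvd_iff.mp (dvd_mul_of_dvd_right hdvd d) n n.lt_succ_self
  have limit : coeff n (c₀ * ∑' i, x i) = ∑ i ∈ F, coeff n (c₀ * x i) :=
    ((WithPiTopology.hasSum_iff_hasSum_coeff R).mp
      ((summable_of_finite_not_X_pow_dvd hx).hasSum.mul_left c₀) n).unique
        (hasSum_sum_of_ne_finset_zero fun i hi => small c₀ hi)
  have finite : Tendsto (fun N => ∑ i ∈ F, coeff n (c N i * x i)) atTop
      (𝓝 (∑ i ∈ F, coeff n (c₀ * x i))) :=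
    tendsto_finsetSum _ fun i _ => ((WithPiTopology.continuous_coeff R n).tendsto _).comp
      ((hc i).mul tendsto_const_nhds)
  rw [limit]
  refine finite.congr' ?_
  filter_upwards [hs.eventually_ge_atTop F] with N hN
  rw [map_sum]
  exact Finset.sum_subset hN fun i _ hi => small _ hi

end Convergence

section ThetaFunctions

variable {R : Type*} [CommRing R]

theorem finite_not_X_pow_dvd_theta_term (s : Rˣ) {u v : ℕ} (huv : 0 < u + v) (n : ℕ) :
    {k : ℤ | ¬ (X ^ n : PowerSeries R) ∣
      monomial (u * triangular k + v * triangular (-k)) (↑(s ^ k) : R)}.Finite := by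
  refine (Set.finite_Icc (-n : ℤ) n).subset fun k hk => ?_
  have hlt := not_le.mp fun h => hk (X_pow_dvd_monomial h _)
  have := natAbs_le_theta_exponent huv k
  constructor <;> omega

theorem monomial_pow_mul_monomial_pow_triangular (s : Rˣ) (u v : ℕ) (k : ℤ) :
    monomial u (s : R) ^ triangular k * monomial v (↑s⁻¹ : R) ^ triangular (-k) =
      monomial (u * triangular k + v * triangular (-k)) ↑(s ^ k) := by
  have hk : (triangular k : ℤ) = k + triangular (-k) := by linarith [triangular_neg k]
  rw [monomial_pow, monomial_pow, monomial_mul_monomial, ← Units.val_pow_eq_pow_val,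
    ← Units.val_pow_eq_pow_val, ← Units.val_mul, ← zpow_natCast, ← zpow_natCast, inv_zpow', hk,
    ← zpow_add, add_neg_cancel_right, mul_comm u, mul_comm v]

variable [TopologicalSpace R]

/-- Ramanujan's theta function `f(s q^u, s⁻¹ q^v) = ∑ₖ sᵏ q^(u k (k + 1) / 2 + v k (k - 1) / 2)`,
summed over all integers `k`. -/
noncomputable def theta (s : Rˣ) (u v : ℕ) : PowerSeries R :=
  ∑' k : ℤ, monomial (u * triangular k + v * triangular (-k)) (↑(s ^ k) : R)

/-- The infinite product `∏ₙ (1 + c q^(m n + r))` over `n ≥ 0`, the `q`-Pochhammer symbol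
`(-c q^r; q^m)_∞`. -/
noncomputable def qProd (c : R) (m r : ℕ) : PowerSeries R :=
  ∏' n : ℕ, (1 + monomial (m * n + r) c)

theorem hasSum_theta (s : Rˣ) {u v : ℕ} (huv : 0 < u + v) :
    HasSum (fun k : ℤ => monomial (u * triangular k + v * triangular (-k)) (↑(s ^ k) : R))
      (theta s u v) :=
  (summable_of_finite_not_X_pow_dvd (finite_not_X_pow_dvd_theta_term s huv)).hasSum

theorem multipliable_qProd [IsTopologicalRing R] (c : R) (m r : ℕ) [NeZero m] :
    Multipliable fun n => 1 + monomial (m * n + r) c :=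
  multipliable_one_add_of_X_pow_dvd fun n => X_pow_dvd_monomial
    ((Nat.le_mul_of_pos_left n (NeZero.pos m)).trans (Nat.le_add_right _ r)) c

end ThetaFunctions

section TripleProduct

variable {R : Type*} [CommRing R] [TopologicalSpace R] [IsTopologicalRing R]

theorem tendsto_prod_one_add_mul_pow (c : R) (m r : ℕ) [NeZero m] :
    Tendsto (fun N => ∏ i ∈ Finset.range N, (1 + monomial r c * monomial m 1 ^ i)) atTop
      (𝓝 (qProd c m r)) := by
  refine (multipliable_qProd c m r).tendsto_prod_tprod_nat.congr fun N => ?_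
  refine Finset.prod_congr rfl fun i _ => ?_
  rw [monomial_pow, monomial_mul_monomial, one_pow, mul_one, add_comm r, mul_comm i]

variable [T2Space R]

theorem exists_tendsto_gaussBinom {Q : PowerSeries R} (hQ : X ∣ Q) :
    ∃ G, (∏' i : ℕ, (1 - Q ^ (i + 1))) * G = 1 ∧
      Tendsto (fun p : ℕ × ℕ => gaussBinom Q (p.1 + p.2) p.2) (atTop ×ˢ atTop) (𝓝 G) := by
  let g (i : ℕ) : PowerSeries R := invOfUnit (1 - Q ^ (i + 1)) 1
  have hdvd (i : ℕ) : X ^ i ∣ Q ^ (i + 1) :=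
    (pow_dvd_pow X i.le_succ).trans (pow_dvd_pow_of_dvd hQ _)
  have mul_g (i : ℕ) : (1 - Q ^ (i + 1)) * g i = 1 :=
    mul_invOfUnit _ _ (by simp [X_dvd_iff.mp hQ])
  have prod_mul_g (m : ℕ) :
      (∏ i ∈ Finset.range m, (1 - Q ^ (i + 1))) * ∏ i ∈ Finset.range m, g i = 1 := by
    rw [← Finset.prod_mul_distrib, Finset.prod_eq_one fun i _ => mul_g i]
  have hprod : Multipliable fun i => 1 - Q ^ (i + 1) := by
    simpa only [sub_eq_add_neg] using
      multipliable_one_add_of_X_pow_dvd fun i => (hdvd i).neg_right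
  have hg : Multipliable g := by
    have : g = fun i => 1 + Q ^ (i + 1) * g i := funext fun i => by linear_combination mul_g i
    rw [this]
    exact multipliable_one_add_of_X_pow_dvd fun i => (hdvd i).mul_right _
  have tendsto_prod := hprod.tendsto_prod_tprod_nat
  have tendsto_g := hg.tendsto_prod_tprod_nat
  have mul_G : (∏' i : ℕ, (1 - Q ^ (i + 1))) * ∏' i, g i = 1 :=
    tendsto_nhds_unique (tendsto_prod.mul tendsto_g)
      (tendsto_const_nhds.congr fun m => (prod_mul_g m).symm)
  refine ⟨∏' i, g i, mul_G, ?_⟩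
  have gauss_eq (m k : ℕ) : gaussBinom Q (m + k) k =
      (∏ i ∈ Finset.range (m + k), (1 - Q ^ (i + 1))) * (∏ i ∈ Finset.range m, g i) *
        ∏ i ∈ Finset.range k, g i := by
    rw [← gaussBinom_add_mul_prod]
    linear_combination -gaussBinom Q (m + k) k * (prod_mul_g m +
      (∏ i ∈ Finset.range m, (1 - Q ^ (i + 1))) * (∏ i ∈ Finset.range m, g i) * prod_mul_g k)
  have tendsto_add : Tendsto (fun p : ℕ × ℕ => p.1 + p.2) (atTop ×ˢ atTop) atTop :=
    tendsto_fst.atTop_add_atTop tendsto_snd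
  have limit := ((tendsto_prod.comp tendsto_add).mul (tendsto_g.comp tendsto_fst)).mul
    (tendsto_g.comp tendsto_snd)
  rw [mul_G, one_mul] at limit
  exact limit.congr fun p => (gauss_eq p.1 p.2).symm

/-- Jacobi's triple product identity. -/
theorem theta_eq_qProd (s : Rˣ) {u v : ℕ} (huv : 0 < u + v) :
    theta s u v =
      qProd (s : R) (u + v) u * qProd (↑s⁻¹ : R) (u + v) v * qProd (-1) (u + v) (u + v) := by
  have : NeZero (u + v) := ⟨huv.ne'⟩
  set a : PowerSeries R := monomial u (s : R) with ha
  set b : PowerSeries R := monomial v (↑s⁻¹ : R) with hb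
  have hab : a * b = monomial (u + v) 1 := by rw [ha, hb, monomial_mul_monomial, s.mul_inv]
  obtain ⟨G, mul_G, tendsto_G⟩ := exists_tendsto_gaussBinom (Q := a * b)
    (by simpa [hab] using X_pow_dvd_monomial (Nat.one_le_iff_ne_zero.mpr huv.ne') (1 : R))
  have euler : ∏' i : ℕ, (1 - (a * b) ^ (i + 1)) = qProd (-1) (u + v) (u + v) := by
    refine tprod_congr fun i => ?_
    rw [hab, monomial_pow, one_pow, map_neg, sub_eq_add_neg, add_one_mul, mul_comm i]
  have tendsto_coeff (k : ℤ) :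
      Tendsto (fun N : ℕ => gaussBinom (a * b) (N + N) (N + k).toNat) atTop (𝓝 G) := by
    have shift (l : ℤ) : Tendsto (fun N : ℕ => (N + l).toNat) atTop atTop :=
      tendsto_atTop.mpr fun b => by
        filter_upwards [eventually_ge_atTop (b + l.natAbs)] with N hN
        omega
    refine (tendsto_G.comp ((shift (-k)).prodMk (shift k))).congr' ?_
    filter_upwards [eventually_ge_atTop k.natAbs] with N hN
    simp only [Function.comp_apply, show ((N : ℤ) + -k).toNat + (N + k).toNat = N + N by omega]
  have key : qProd (s : R) (u + v) u * qProd (↑s⁻¹ : R) (u + v) v = G * theta s u v := by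
    refine tendsto_nhds_unique ((tendsto_prod_one_add_mul_pow _ _ _).mul
      (tendsto_prod_one_add_mul_pow _ _ _)) ?_
    simp only [← hab, ← ha, ← hb, prod_mul_prod_eq_sum_Icc_gaussBinom]
    simp only [ha, hb, monomial_pow_mul_monomial_pow_triangular]
    exact tendsto_sum_mul_of_finite_not_X_pow_dvd (finite_not_X_pow_dvd_theta_term s huv)
      Finset.tendsto_Icc_neg tendsto_coeff
  rw [key, ← euler]
  linear_combination -theta s u v * mul_G

end TripleProduct

section QProd

variable {R : Type*} [CommRing R] [TopologicalSpace R]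

theorem constantCoeff_qProd [IsTopologicalRing R] [T2Space R] (c : R) (m r : ℕ) [NeZero m]
    [NeZero r] : constantCoeff (qProd c m r) = 1 := by
  have hr : r ≠ 0 := NeZero.ne r
  rw [qProd, (multipliable_qProd c m r).map_tprod _ (WithPiTopology.continuous_constantCoeff R)]
  refine (tprod_congr fun n => ?_).trans tprod_one
  rw [map_add, map_one, ← coeff_zero_eq_constantCoeff_apply, coeff_monomial,
    if_neg (by omega), add_zero]

theorem qProd_mul_qProd_neg [IsTopologicalRing R] [T2Space R] (c : R) (m r : ℕ) [NeZero m] :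
    qProd c m r * qProd (-c) m r = qProd (-c ^ 2) (2 * m) (2 * r) := by
  rw [qProd, qProd, ← (multipliable_qProd c m r).tprod_mul (multipliable_qProd (-c) m r)]
  refine tprod_congr fun n => ?_
  have square : monomial (2 * m * n + 2 * r) (-c ^ 2) = -monomial (m * n + r) c ^ 2 := by
    rw [monomial_pow, map_neg, mul_assoc, ← mul_add]
  rw [square, map_neg]
  ring

theorem prod_range_mul_left {M : Type*} [CommMonoid M] (f : ℕ → M) (d N : ℕ) :
    ∏ n ∈ Finset.range (d * N), f n =
      ∏ i ∈ Finset.range d, ∏ n ∈ Finset.range N, f (d * n + i) := by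
  induction N with
  | zero => simp
  | succ N ih =>
    simp only [mul_add_one, Finset.prod_range_add, ih, Finset.prod_range_succ,
      Finset.prod_mul_distrib]

theorem qProd_eq_prod [IsTopologicalRing R] [T2Space R] (d : ℕ) [NeZero d] (c : R) (m r : ℕ)
    [NeZero m] : qProd c m r = ∏ i ∈ Finset.range d, qProd c (d * m) (r + i * m) := by
  have tendsto_mul : Tendsto (fun N => d * N) atTop atTop :=
    tendsto_id.const_mul_atTop' (NeZero.pos d)
  refine tendsto_nhds_unique ((multipliable_qProd c m r).tendsto_prod_tprod_nat.comp tendsto_mul)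
    ((tendsto_finsetProd _ fun i _ =>
      (multipliable_qProd c (d * m) (r + i * m)).tendsto_prod_tprod_nat).congr fun N => ?_)
  rw [Function.comp_apply, prod_range_mul_left]
  refine Finset.prod_congr rfl fun i _ => Finset.prod_congr rfl fun n _ => ?_
  rw [show m * (d * n + i) + r = d * m * n + (r + i * m) by ring]

end QProd

section Expand

variable {R : Type*} [CommRing R] [TopologicalSpace R]

theorem continuous_expand (p : ℕ) (hp : p ≠ 0) :
    Continuous (expand p hp : PowerSeries R → PowerSeries R) := by
  refine continuous_iff_continuousAt.mpr fun F =>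
    (WithPiTopology.tendsto_iff_coeff_tendsto R _ _ _).mpr fun n => ?_
  by_cases h : p ∣ n
  · obtain ⟨k, rfl⟩ := h
    simpa only [coeff_expand_mul] using (WithPiTopology.continuous_coeff R k).tendsto F
  · simpa only [coeff_expand_of_not_dvd _ _ _ h] using tendsto_const_nhds

theorem expand_theta [T2Space R] (p : ℕ) (hp : p ≠ 0) (s : Rˣ) {u v : ℕ} (huv : 0 < u + v) :
    expand p hp (theta s u v) = theta s (p * u) (p * v) := by
  rw [← ((hasSum_theta s huv).map (expand p hp) (continuous_expand p hp)).tsum_eq, theta]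
  refine tsum_congr fun k => ?_
  rw [Function.comp_apply, expand_monomial, mul_add, mul_assoc, mul_assoc]

theorem expand_qProd [IsTopologicalRing R] [T2Space R] (p : ℕ) (hp : p ≠ 0) (c : R) (m r : ℕ)
    [NeZero m] : expand p hp (qProd c m r) = qProd c (p * m) (p * r) := by
  rw [qProd, (multipliable_qProd c m r).map_tprod _ (continuous_expand p hp)]
  refine tprod_congr fun n => ?_
  rw [map_add, map_one, expand_monomial, mul_add, mul_assoc]

end Expand

section ProductIdentities

/-- Ramanujan's `φ(q^k) = ∑ₙ q^(k n²)`. -/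
noncomputable def phi (k : ℕ) : PowerSeries ℤ := theta 1 k k

/-- Ramanujan's `φ(-q^k) = ∑ₙ (-1)ⁿ q^(k n²)`. -/
noncomputable def phiNeg (k : ℕ) : PowerSeries ℤ := theta (-1) k k

/-- Ramanujan's `ψ(q^k) = ∑ₙ q^(k n (n + 1) / 2)` over `n ≥ 0`, in its bilateral form
`f(q^k, q^(3 k))`. -/
noncomputable def psi (k : ℕ) : PowerSeries ℤ := theta 1 k (3 * k)

/-- Ramanujan's `f(q^k, q^(2 k))`, the companion of `ψ` in the `3`-dissection of `ψ`. -/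
noncomputable def pent (k : ℕ) : PowerSeries ℤ := theta 1 k (2 * k)

/-- Ramanujan's `f(-q^k, -q^(5 k)) = Ω(-q^k)`, the companion of `φ` in the `3`-dissection of
`φ(-q)`. -/
noncomputable def omegaNeg (k : ℕ) : PowerSeries ℤ := theta (-1) k (5 * k)

/-- Euler's product `∏ₙ (1 - q^(k n))` over `n ≥ 1`. -/
noncomputable def euler (k : ℕ) : PowerSeries ℤ := qProd (-1) k k

variable (k : ℕ) [NeZero k]

theorem constantCoeff_euler : constantCoeff (euler k) = 1 := constantCoeff_qProd _ k k

theorem euler_ne_zero : euler k ≠ 0 := fun h => by simpa [h] using constantCoeff_euler k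

theorem qProd_two_split (c : ℤ) (m r : ℕ) [NeZero m] :
    qProd c m r = qProd c (2 * m) r * qProd c (2 * m) (r + m) := by
  simpa [Finset.prod_range_succ] using qProd_eq_prod 2 c m r

theorem qProd_three_split (c : ℤ) (m r : ℕ) [NeZero m] :
    qProd c m r = qProd c (3 * m) r * qProd c (3 * m) (r + m) * qProd c (3 * m) (r + 2 * m) := by
  simpa [Finset.prod_range_succ] using qProd_eq_prod 3 c m r

theorem qProd_one_mul_qProd_neg_one (m r : ℕ) [NeZero m] :
    qProd (1 : ℤ) m r * qProd (-1) m r = qProd (-1) (2 * m) (2 * r) := by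
  simpa using qProd_mul_qProd_neg (1 : ℤ) m r

theorem euler_eq_qProd_mul_euler : euler k = qProd (-1) (2 * k) k * euler (2 * k) := by
  rw [euler, euler, qProd_two_split, ← two_mul]

theorem qProd_one_mul_qProd_neg_one_odd : qProd (1 : ℤ) k k * qProd (-1) (2 * k) k = 1 := by
  have h := qProd_one_mul_qProd_neg_one k k
  have h' := euler_eq_qProd_mul_euler k
  rw [euler, euler] at h'
  refine mul_right_cancel₀ (euler_ne_zero (2 * k)) ?_
  rw [euler]
  linear_combination h - qProd (1 : ℤ) k k * h'

theorem phi_eq_qProd : phi k = qProd 1 (2 * k) k ^ 2 * euler (2 * k) := by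
  rw [phi, theta_eq_qProd _ (by have := NeZero.pos k; omega), ← two_mul, euler]
  simp [sq]

theorem phiNeg_eq_qProd : phiNeg k = qProd (-1) (2 * k) k ^ 2 * euler (2 * k) := by
  rw [phiNeg, theta_eq_qProd _ (by have := NeZero.pos k; omega), ← two_mul, euler]
  simp [sq]

theorem psi_eq_qProd : psi k = qProd 1 (2 * k) k * euler (4 * k) := by
  rw [psi, theta_eq_qProd _ (by have := NeZero.pos k; omega), qProd_two_split 1 (2 * k) k, euler,
    show k + 3 * k = 4 * k by ring, show 2 * (2 * k) = 4 * k by ring,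
    show k + 2 * k = 3 * k by ring]
  simp

theorem pent_eq_qProd : pent k = qProd 1 (3 * k) k * qProd 1 (3 * k) (2 * k) * euler (3 * k) := by
  rw [pent, theta_eq_qProd _ (by have := NeZero.pos k; omega), euler,
    show k + 2 * k = 3 * k by ring]
  simp

theorem omegaNeg_eq_qProd :
    omegaNeg k = qProd (-1) (6 * k) k * qProd (-1) (6 * k) (5 * k) * euler (6 * k) := by
  rw [omegaNeg, theta_eq_qProd _ (by have := NeZero.pos k; omega), euler,
    show k + 5 * k = 6 * k by ring]
  simp

theorem phiNeg_mul_euler : phiNeg k * euler (2 * k) = euler k ^ 2 := by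
  rw [phiNeg_eq_qProd, euler_eq_qProd_mul_euler k]
  ring

theorem psi_mul_euler : psi k * euler k = euler (2 * k) ^ 2 := by
  have h := qProd_one_mul_qProd_neg_one (2 * k) k
  rw [psi_eq_qProd, euler_eq_qProd_mul_euler k, euler_eq_qProd_mul_euler (2 * k), ← h,
    show 2 * (2 * k) = 4 * k by ring]
  ring

theorem psi_mul_phiNeg : psi k * phiNeg k = euler k * euler (2 * k) := by
  refine mul_right_cancel₀ (euler_ne_zero (2 * k)) ?_
  linear_combination psi k * phiNeg_mul_euler k + euler k * psi_mul_euler k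

theorem phiNeg_two_mul_eq_qProd :
    phiNeg (2 * k) = qProd 1 (2 * k) k * qProd (-1) (2 * k) k * euler (2 * k) := by
  rw [phiNeg_eq_qProd, euler_eq_qProd_mul_euler (2 * k), ← qProd_one_mul_qProd_neg_one (2 * k) k]
  ring

theorem phi_mul_phiNeg : phi k * phiNeg k = phiNeg (2 * k) ^ 2 := by
  rw [phi_eq_qProd, phiNeg_eq_qProd, phiNeg_two_mul_eq_qProd]
  ring

theorem pent_mul_omegaNeg : pent k * omegaNeg k = psi (3 * k) * phiNeg (3 * k) := by
  have odd_one := qProd_one_mul_qProd_neg_one_odd k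
  have odd_three := qProd_one_mul_qProd_neg_one_odd (3 * k)
  have split_one := qProd_three_split 1 k k
  have split_neg := qProd_three_split (-1) (2 * k) k
  rw [show k + k = 2 * k by ring, show k + 2 * k = 3 * k by ring] at split_one
  rw [show 3 * (2 * k) = 6 * k by ring, show k + 2 * k = 3 * k by ring,
    show k + 2 * (2 * k) = 5 * k by ring] at split_neg
  rw [show 2 * (3 * k) = 6 * k by ring] at odd_three
  rw [split_one, split_neg] at odd_one
  rw [psi_mul_phiNeg, pent_eq_qProd, omegaNeg_eq_qProd, show 2 * (3 * k) = 6 * k by ring]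
  linear_combination euler (3 * k) * euler (6 * k) * (odd_one -
    qProd 1 (3 * k) k * qProd 1 (3 * k) (2 * k) * qProd (-1) (6 * k) k *
      qProd (-1) (6 * k) (5 * k) * odd_three)

theorem omegaNeg_mul_euler :
    omegaNeg k * euler (2 * k) * euler (3 * k) = euler k * euler (6 * k) ^ 2 := by
  have split := qProd_three_split (-1) (2 * k) k
  rw [show 3 * (2 * k) = 6 * k by ring, show k + 2 * k = 3 * k by ring,
    show k + 2 * (2 * k) = 5 * k by ring] at split
  rw [omegaNeg_eq_qProd, euler_eq_qProd_mul_euler k, euler_eq_qProd_mul_euler (3 * k), split,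
    show 2 * (3 * k) = 6 * k by ring]
  ring

theorem psi_mul_psi_mul_phiNeg_mul_omegaNeg :
    psi k * psi (3 * k) * phiNeg (3 * k) * omegaNeg k = euler (2 * k) * euler (6 * k) ^ 3 := by
  have h := psi_mul_phiNeg (3 * k)
  rw [show 2 * (3 * k) = 6 * k by ring] at h
  refine mul_right_cancel₀ (mul_ne_zero (euler_ne_zero k) (euler_ne_zero (2 * k))) ?_
  linear_combination psi k * omegaNeg k * euler k * euler (2 * k) * h +
    euler (6 * k) * psi k * euler k * omegaNeg_mul_euler k +
    euler k * euler (6 * k) ^ 3 * psi_mul_euler k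

end ProductIdentities

section GeneratingFunction

variable (t : ℕ) [NeZero t]

theorem schurOverGenFun_mul_qProd :
    schurOverGenFun t * (qProd 1 (2 * t) t * qProd (-1) 2 1) =
      qProd 1 2 1 * qProd (-1) (2 * t) t := by
  have ht : 1 ≤ t := NeZero.one_le
  have conv := multipliable_qProd (R := ℤ)
  rw [schurOverGenFun, qProd, qProd, qProd, qProd, ← (conv 1 _ _).tprod_mul (conv (-1) _ _),
    ← (multipliable_schurOverFactor ht).tprod_mul ((conv 1 _ _).mul (conv (-1) _ _)),
    ← (conv 1 _ _).tprod_mul (conv (-1) _ _)]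
  refine tprod_congr fun n => ?_
  have h := schurOverFactor_mul ht n
  rw [show 2 * t * n + t = t * (2 * n + 1) by ring]
  simp only [map_neg, ← X_pow_eq]
  linear_combination h

theorem phiNeg_mul_phiNeg_mul_schurOverGenFun :
    phiNeg 2 * phiNeg (2 * t) * schurOverGenFun t = phi 1 * phiNeg t := by
  have phiNeg_two := phiNeg_two_mul_eq_qProd 1
  rw [mul_one] at phiNeg_two
  rw [phiNeg_two, phiNeg_two_mul_eq_qProd, phi_eq_qProd, phiNeg_eq_qProd]
  linear_combination qProd 1 2 1 * euler 2 * qProd (-1) (2 * t) t * euler (2 * t) *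
    schurOverGenFun_mul_qProd t

end GeneratingFunction

section Dissection

theorem hasSum_of_bijective_uncurry {ι β γ M : Type*} [Fintype ι] [AddCommMonoid M]
    [TopologicalSpace M] [ContinuousAdd M] {f : β → M} {e : ι → γ → β} {a : ι → M}
    (he : (Function.uncurry e).Bijective) (h : ∀ i, HasSum (f ∘ e i) (a i)) :
    HasSum f (∑ i, a i) := by
  have inj (i : ι) : (e i).Injective := he.injective.comp (Prod.mk_right_injective i)
  have extended := hasSum_sum (s := Finset.univ) fun i _ => (hasSum_extend_zero (inj i)).mpr (h i)
  have sum_extend : (fun b => ∑ i, Function.extend (e i) (f ∘ e i) 0 b) = f := by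
    funext b
    obtain ⟨⟨i, c⟩, rfl⟩ := he.surjective b
    rw [Finset.sum_eq_single i, Function.uncurry_apply_pair, (inj i).extend_apply,
      Function.comp_apply]
    · rintro j - hj
      refine Function.extend_apply' _ _ _ ?_
      rintro ⟨c', hc'⟩
      exact hj (congrArg Prod.fst (he.injective (a₁ := (j, c')) (a₂ := (i, c)) hc'))
    · exact fun hi => absurd (Finset.mem_univ i) hi
  rwa [sum_extend] at extended

theorem theta_exponent_mul_add {m u v U V : ℕ} {r : ℤ} (hadd : U + V = m ^ 2 * (u + v))
    (hsub : (U - V : ℤ) = m * (u * (2 * r + 1) + v * (2 * r - 1))) (k : ℤ) :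
    u * triangular (m * k + r) + v * triangular (-(m * k + r)) =
      u * triangular r + v * triangular (-r) + (U * triangular k + V * triangular (-k)) := by
  have hadd' : (U + V : ℤ) = m ^ 2 * (u + v) := mod_cast hadd
  zify
  rw [triangular_neg, triangular_neg, triangular_neg]
  refine mul_left_cancel₀ two_ne_zero ?_
  linear_combination (u + v : ℤ) * (two_mul_triangular (m * k + r) - two_mul_triangular r) -
    (U + V : ℤ) * two_mul_triangular k - k ^ 2 * hadd' - k * hsub

variable {R : Type*} [CommRing R] [TopologicalSpace R] [IsTopologicalRing R] [T2Space R]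

theorem theta_eq_sum (m : ℕ) [NeZero m] {ι : Type*} [Fintype ι] {r : ι → ℤ}
    (hr : ∀ n : ℤ, ∃! i, (m : ℤ) ∣ n - r i) (s : Rˣ) {u v : ℕ} (huv : 0 < u + v) {U V : ι → ℕ}
    (hadd : ∀ i, U i + V i = m ^ 2 * (u + v))
    (hsub : ∀ i, (U i - V i : ℤ) = m * (u * (2 * r i + 1) + v * (2 * r i - 1))) :
    theta s u v = ∑ i, monomial (u * triangular (r i) + v * triangular (-r i)) (↑(s ^ r i) : R) *
      theta (s ^ m) (U i) (V i) := by
  have hm : 0 < m := NeZero.pos m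
  refine (hasSum_theta s huv).unique
    (hasSum_of_bijective_uncurry (e := fun i k => m * k + r i) ⟨?_, fun n => ?_⟩ fun i => ?_)
  · rintro ⟨i, k⟩ ⟨j, l⟩ (hij : m * k + r i = m * l + r j)
    obtain rfl : i = j := (hr (m * k + r i)).unique ⟨k, by ring⟩ ⟨l, by rw [hij]; ring⟩
    rw [mul_left_cancel₀ (mod_cast hm.ne') (add_right_cancel hij)]
  · obtain ⟨i, ⟨k, hk⟩, -⟩ := hr n
    exact ⟨(i, k), (sub_eq_iff_eq_add.mp hk).symm⟩
  · have hUV : 0 < U i + V i := by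
      rw [hadd]
      positivity
    have terms (k : ℤ) : monomial (u * triangular (r i) + v * triangular (-r i)) (↑(s ^ r i) : R) *
        monomial (U i * triangular k + V i * triangular (-k)) (↑((s ^ m) ^ k) : R) =
          monomial (u * triangular (m * k + r i) + v * triangular (-(m * k + r i)))
            (↑(s ^ (m * k + r i)) : R) := by
      rw [theta_exponent_mul_add (hadd i) (hsub i), monomial_mul_monomial, ← Units.val_mul,
        ← zpow_natCast, ← zpow_mul, ← zpow_add, add_comm (r i)]
    have scaled := (hasSum_theta (s ^ m) hUV).mul_left
      (monomial (u * triangular (r i) + v * triangular (-r i)) (↑(s ^ r i) : R))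
    simp only [terms] at scaled
    exact scaled

theorem theta_two_dissection (s : Rˣ) {u v : ℕ} (hvu : v ≤ u) (huv : 0 < u + v) :
    theta s u v = theta (s ^ 2) (3 * u + v) (u + 3 * v) +
      C (↑s⁻¹ : R) * X ^ v * theta (s ^ 2) (u - v) (3 * u + 5 * v) := by
  have hr (n : ℤ) : ∃! i : Fin 2, ((2 : ℕ) : ℤ) ∣ n - ![0, -1] i := by
    simp only [ExistsUnique, Fin.exists_fin_two, Fin.forall_fin_two]
    simp
    omega
  rw [theta_eq_sum 2 hr s huv (U := ![3 * u + v, u - v]) (V := ![u + 3 * v, 3 * u + 5 * v])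
    (by simp [Fin.forall_fin_two]; omega) (by simp [Fin.forall_fin_two]; omega)]
  simp [triangular, monomial_eq_C_mul_X_pow]

theorem theta_three_dissection (s : Rˣ) {u v : ℕ} (huv : 0 < u + v) :
    theta s u v = theta (s ^ 3) (6 * u + 3 * v) (3 * u + 6 * v) +
      C (s : R) * X ^ u * theta (s ^ 3) (9 * u + 6 * v) (3 * v) +
        C (↑s⁻¹ : R) * X ^ v * theta (s ^ 3) (3 * u) (6 * u + 9 * v) := by
  have hr (n : ℤ) : ∃! i : Fin 3, ((3 : ℕ) : ℤ) ∣ n - ![0, 1, -1] i := by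
    simp only [ExistsUnique, Fin.exists_fin_succ, Fin.forall_fin_succ]
    simp
    omega
  rw [theta_eq_sum 3 hr s huv (U := ![6 * u + 3 * v, 9 * u + 6 * v, 3 * u])
    (V := ![3 * u + 6 * v, 3 * v, 6 * u + 9 * v])
    (by simp [Fin.forall_fin_succ]; omega) (by simp [Fin.forall_fin_succ]; omega)]
  simp [triangular, monomial_eq_C_mul_X_pow, Fin.sum_univ_succ, add_assoc]

end Dissection

section ThetaDissection

instance {R : Type*} [Semiring R] [CharZero R] : CharZero (PowerSeries R) :=
  charZero_of_injective_ringHom C_injective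

variable (k : ℕ) [NeZero k]

theorem theta_comm {R : Type*} [CommRing R] [TopologicalSpace R] (s : Rˣ) (u v : ℕ) :
    theta s u v = theta s⁻¹ v u := by
  rw [theta, theta, ← (Equiv.neg ℤ).tsum_eq]
  simp [add_comm]

theorem theta_one_zero_right : theta (1 : ℤˣ) k 0 = 2 * psi k := by
  rw [theta_two_dissection 1 (Nat.zero_le k) (NeZero.pos k), one_pow, theta_comm 1 (3 * k + 0)]
  simp [psi, two_mul]

theorem theta_two_dissection_self (s : ℤˣ) :
    theta s k k = phi (4 * k) + C (s : ℤ) * X ^ k * (2 * psi (8 * k)) := by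
  rw [theta_two_dissection s le_rfl (Nat.add_pos_left (NeZero.pos k) k), Int.units_sq, Nat.sub_self,
    theta_comm 1 0, inv_one, Int.units_inv_eq_self, show 3 * k + k = 4 * k by ring,
    show k + 3 * k = 4 * k by ring, show 3 * k + 5 * k = 8 * k by ring, theta_one_zero_right, phi]

theorem phi_two_dissection : phi k = phi (4 * k) + X ^ k * (2 * psi (8 * k)) := by
  simpa [phi] using theta_two_dissection_self k 1

theorem phiNeg_two_dissection : phiNeg k = phi (4 * k) - X ^ k * (2 * psi (8 * k)) := by
  simpa [phiNeg, ← sub_eq_add_neg] using theta_two_dissection_self k (-1)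

theorem psi_three_dissection : psi k = pent (3 * k) + X ^ k * psi (9 * k) := by
  have h := theta_three_dissection (R := ℤ) 1 (u := k) (v := 0) (NeZero.pos k)
  rw [one_pow, theta_comm 1 (3 * k), inv_one] at h
  simp only [Units.val_one, map_one, one_mul, pow_zero, mul_zero, add_zero,
    theta_one_zero_right] at h
  rw [show 6 * k = 2 * (3 * k) by ring, theta_comm 1 (2 * (3 * k)), inv_one, ← pent] at h
  refine mul_left_cancel₀ two_ne_zero ?_
  linear_combination h

theorem phiNeg_three_dissection : phiNeg k = phiNeg (9 * k) - 2 * X ^ k * omegaNeg (3 * k) := by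
  have h := theta_three_dissection (R := ℤ) (-1) (Nat.add_pos_left (NeZero.pos k) k)
  have cube : (-1 : ℤˣ) ^ 3 = -1 := rfl
  rw [cube, Int.units_inv_eq_self, theta_comm _ (9 * k + 6 * k), Int.units_inv_eq_self,
    show 6 * k + 3 * k = 9 * k by ring, show 3 * k + 6 * k = 9 * k by ring,
    show 6 * k + 9 * k = 5 * (3 * k) by ring, show 9 * k + 6 * k = 5 * (3 * k) by ring] at h
  rw [phiNeg, phiNeg, omegaNeg, h]
  simp only [Units.val_neg, Units.val_one, map_neg, map_one]
  ring

end ThetaDissection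

section PhiMulPhi

theorem hasSum_theta_mul_theta {R : Type*} [CommRing R] [TopologicalSpace R] [IsTopologicalRing R]
    [T3Space R] (s s' : Rˣ) {u v u' v' : ℕ} (huv : 0 < u + v) (huv' : 0 < u' + v') :
    HasSum (fun p : ℤ × ℤ => monomial (u * triangular p.1 + v * triangular (-p.1) +
        (u' * triangular p.2 + v' * triangular (-p.2))) (↑(s ^ p.1) * ↑(s' ^ p.2) : R))
      (theta s u v * theta s' u' v') := by
  have summable : Summable fun p : ℤ × ℤ =>
      monomial (u * triangular p.1 + v * triangular (-p.1)) (↑(s ^ p.1) : R) *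
        monomial (u' * triangular p.2 + v' * triangular (-p.2)) (↑(s' ^ p.2) : R) :=
    summable_of_finite_not_X_pow_dvd fun n =>
      ((finite_not_X_pow_dvd_theta_term s huv n).prod
        (finite_not_X_pow_dvd_theta_term s' huv' n)).subset fun p hp =>
          ⟨fun h => hp (dvd_mul_of_dvd_left h _), fun h => hp (dvd_mul_of_dvd_right h _)⟩
  simpa only [monomial_mul_monomial] using (hasSum_theta s huv).mul (hasSum_theta s' huv') summable

theorem triangular_neg_one_sub (k : ℤ) : triangular (-1 - k) = triangular k := by
  have := two_mul_triangular k
  have := two_mul_triangular (-1 - k)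
  have : (2 : ℤ) * triangular (-1 - k) = 2 * triangular k := by linarith
  omega

variable (k : ℕ) [NeZero k]

/-- The series `∑ q^(k (2 T(a) + 6 T(a - 2 c)))` over all integers `a` and `c`, where `T(n)` is the
`n`-th triangular number: the part of `4 ψ(q^(2 k)) ψ(q^(6 k)) = ∑ q^(k (2 T(a) + 6 T(b)))` with
`a ≡ b` modulo `2`. -/
noncomputable def evenTriangularPairs (k : ℕ) : PowerSeries ℤ :=
  ∑' p : ℤ × ℤ, X ^ (2 * k * triangular p.1 + 6 * k * triangular (p.1 - 2 * p.2))

theorem hasSum_psi_mul_psi :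
    HasSum (fun p : ℤ × ℤ =>
      (X : PowerSeries ℤ) ^ (2 * k * triangular p.1 + 6 * k * triangular p.2))
      (4 * psi (2 * k) * psi (6 * k)) := by
  have h := hasSum_theta_mul_theta (R := ℤ) 1 1 (u := 2 * k) (v := 0) (u' := 6 * k) (v' := 0)
    (NeZero.pos (2 * k)) (NeZero.pos (6 * k))
  rw [theta_one_zero_right, theta_one_zero_right] at h
  simp only [zero_mul, add_zero, one_zpow, Units.val_one, mul_one, ← X_pow_eq] at h
  rwa [show 4 * psi (2 * k) * psi (6 * k) = 2 * psi (2 * k) * (2 * psi (6 * k)) by ring]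

theorem hasSum_evenTriangularPairs :
    HasSum (fun p : ℤ × ℤ => (X : PowerSeries ℤ) ^
      (2 * k * triangular p.1 + 6 * k * triangular (p.1 - 2 * p.2))) (evenTriangularPairs k) := by
  have inj : Function.Injective fun p : ℤ × ℤ => (p.1, p.1 - 2 * p.2) := by
    rintro ⟨a, b⟩ ⟨c, d⟩ h
    simp only [Prod.mk.injEq] at h ⊢
    omega
  exact ((hasSum_psi_mul_psi k).summable.comp_injective inj).hasSum

theorem four_mul_psi_mul_psi : 4 * psi (2 * k) * psi (6 * k) = 2 * evenTriangularPairs k := by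
  refine ((hasSum_psi_mul_psi k).unique (hasSum_of_bijective_uncurry
    (e := fun (i : Fin 2) (p : ℤ × ℤ) => (p.1, ![p.1 - 2 * p.2, -1 - (p.1 - 2 * p.2)] i))
    (a := fun _ => evenTriangularPairs k) ⟨?_, fun (x, y) => ?_⟩ ?_)).trans ?_
  · rintro ⟨i, a, c⟩ ⟨j, b, d⟩ h
    fin_cases i <;> fin_cases j <;> simp at h ⊢ <;> omega
  · rcases Int.emod_two_eq_zero_or_one (x - y) with h | h
    · exact ⟨(0, x, (x - y) / 2), by simp; omega⟩
    · exact ⟨(1, x, (x + y + 1) / 2), by simp; omega⟩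
  · refine Fin.forall_fin_two.mpr ⟨hasSum_evenTriangularPairs k, ?_⟩
    simpa [Function.comp_def, triangular_neg_one_sub] using hasSum_evenTriangularPairs k
  · simp

theorem hasSum_phi_mul_phi_sub_phiNeg_mul_phiNeg :
    HasSum (fun p : ℤ × ℤ => monomial (k * p.1.natAbs ^ 2 + 3 * k * p.2.natAbs ^ 2)
      (1 - ((-1 : ℤˣ) ^ (p.1 + p.2) : ℤˣ) : ℤ))
      (phi k * phi (3 * k) - phiNeg k * phiNeg (3 * k)) := by
  have square (k : ℕ) (x : ℤ) : k * triangular x + k * triangular (-x) = k * x.natAbs ^ 2 := by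
    rw [← mul_add, triangular_add_triangular_neg]
  have pos (k : ℕ) [NeZero k] : 0 < k + k := Nat.add_pos_left (NeZero.pos k) k
  have h := (hasSum_theta_mul_theta (R := ℤ) 1 1 (pos k) (pos (3 * k))).sub
    (hasSum_theta_mul_theta (-1) (-1) (pos k) (pos (3 * k)))
  simp only [square, one_zpow, Units.val_one, mul_one, ← Units.val_mul, ← zpow_add,
    ← map_sub] at h
  exact h

theorem phi_mul_phi_sub_phiNeg_mul_phiNeg :
    phi k * phi (3 * k) - phiNeg k * phiNeg (3 * k) = 4 * X ^ k * psi (2 * k) * psi (6 * k) := by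
  have inj : Function.Injective fun p : ℤ × ℤ => (2 * p.1 - 3 * p.2 + 1, p.2) := by
    rintro ⟨a, b⟩ ⟨c, d⟩ h
    simp only [Prod.mk.injEq] at h ⊢
    omega
  have odd_part := (inj.hasSum_iff fun (x, y) hxy => ?_).mpr
    (hasSum_phi_mul_phi_sub_phiNeg_mul_phiNeg k)
  · have term (p : ℤ × ℤ) : 2 * X ^ k * (X : PowerSeries ℤ) ^
        (2 * k * triangular p.1 + 6 * k * triangular (p.1 - 2 * p.2)) =
          monomial (k * (2 * p.1 - 3 * p.2 + 1).natAbs ^ 2 + 3 * k * p.2.natAbs ^ 2)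
            (1 - ((-1 : ℤˣ) ^ (2 * p.1 - 3 * p.2 + 1 + p.2) : ℤˣ) : ℤ) := by
      have exponent : k * (2 * p.1 - 3 * p.2 + 1).natAbs ^ 2 + 3 * k * p.2.natAbs ^ 2 =
          k + (2 * k * triangular p.1 + 6 * k * triangular (p.1 - 2 * p.2)) := by
        zify
        rw [sq_abs, sq_abs]
        linear_combination (-k : ℤ) * two_mul_triangular p.1 -
          3 * k * two_mul_triangular (p.1 - 2 * p.2)
      have odd : Odd (2 * p.1 - 3 * p.2 + 1 + p.2) := ⟨p.1 - p.2, by ring⟩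
      rw [exponent, odd.neg_one_zpow, mul_assoc, ← pow_add,
        monomial_eq_C_mul_X_pow]
      rfl
    have h := (hasSum_evenTriangularPairs k).mul_left (2 * X ^ k)
    simp only [term] at h
    linear_combination odd_part.unique h - X ^ k * four_mul_psi_mul_psi k
  · have even : Even (x + y) := by
      by_contra h
      obtain ⟨m, hm⟩ := Int.not_even_iff_odd.mp h
      exact hxy ⟨(m + y, y), Prod.ext (by grind) rfl⟩
    rw [even.neg_one_zpow, Units.val_one, sub_self, map_zero]

end PhiMulPhi

section Sections

variable {R : Type*} [CommRing R]

/-- The series `∑ aₘₙ₊ᵣ qⁿ` extracted from `∑ aₙ qⁿ`. -/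
noncomputable def sect (m r : ℕ) : PowerSeries R →+ PowerSeries R where
  toFun F := mk fun n => coeff (m * n + r) F
  map_add' F G := by ext n; simp
  map_zero' := by ext n; simp

@[simp]
theorem coeff_sect (m r n : ℕ) (F : PowerSeries R) :
    coeff n (sect m r F) = coeff (m * n + r) F := by
  simp [sect]

theorem map_sect {S : Type*} [CommRing S] (f : R →+* S) (m r : ℕ) (F : PowerSeries R) :
    map f (sect m r F) = sect m r (map f F) := by
  ext n
  simp

variable {m : ℕ} [NeZero m]

theorem sect_X_pow_mul_expand (r j : Fin m) (G : PowerSeries R) :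
    sect m r (X ^ (j : ℕ) * expand m (NeZero.ne m) G) = if j = r then G else 0 := by
  ext n
  rw [coeff_sect, coeff_X_pow_mul', coeff_expand]
  split_ifs with hle hdvd heq heq heq
  · rw [heq, Nat.add_sub_cancel, Nat.mul_div_cancel_left _ (NeZero.pos m)]
  · have hmod := (Nat.modEq_iff_dvd' hle).mpr hdvd
    rw [Nat.ModEq, Nat.mul_add_mod, Nat.mod_eq_of_lt j.2, Nat.mod_eq_of_lt r.2] at hmod
    exact absurd (Fin.ext hmod) heq
  · exact absurd ⟨n, by rw [heq, Nat.add_sub_cancel]⟩ hdvd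
  · simp
  · exact absurd (heq ▸ Nat.le_add_left _ _) hle
  · simp

theorem sect_of_dissection {F : PowerSeries R} {A : Fin m → PowerSeries R}
    (hF : F = ∑ j : Fin m, X ^ (j : ℕ) * expand m (NeZero.ne m) (A j)) (r : Fin m) :
    sect m r F = A r := by
  simp [hF, sect_X_pow_mul_expand]

theorem eq_sum_X_pow_mul_expand_sect (m : ℕ) [NeZero m] (F : PowerSeries R) :
    F = ∑ j : Fin m, X ^ (j : ℕ) * expand m (NeZero.ne m) (sect m j F) := by
  ext n
  have hr : n % m < m := Nat.mod_lt n (NeZero.pos m)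
  have h := congrArg (coeff (n / m)) (sect_of_dissection
    (rfl : _ = ∑ j : Fin m, X ^ (j : ℕ) * expand m (NeZero.ne m) (sect m j F)) ⟨n % m, hr⟩)
  rw [coeff_sect, coeff_sect, Nat.div_add_mod] at h
  exact h.symm

theorem sect_zero_expand (m : ℕ) [NeZero m] (F : PowerSeries R) :
    sect m 0 (expand m (NeZero.ne m) F) = F := by
  ext n
  rw [coeff_sect, add_zero, coeff_expand_mul]

theorem sect_zero_ofNat (m c : ℕ) [NeZero m] [c.AtLeastTwo] :
    sect m 0 (OfNat.ofNat c : PowerSeries R) = OfNat.ofNat c := by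
  conv_lhs => rw [← map_ofNat (expand m (NeZero.ne m)) c, sect_zero_expand]

theorem sect_expand_mul {r : ℕ} (hr : r < m) (G F : PowerSeries R) :
    sect m r (expand m (NeZero.ne m) G * F) = G * sect m r F := by
  refine sect_of_dissection (A := fun j => G * sect m j F) ?_ ⟨r, hr⟩
  conv_lhs => rw [eq_sum_X_pow_mul_expand_sect m F]
  rw [Finset.mul_sum]
  exact Finset.sum_congr rfl fun j _ => by rw [map_mul]; ring

theorem sect_two_of_dissection {F A B : PowerSeries R}
    (hF : F = expand 2 two_ne_zero A + X * expand 2 two_ne_zero B) :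
    sect 2 0 F = A ∧ sect 2 1 F = B := by
  have h := sect_of_dissection (m := 2) (A := ![A, B]) (by simpa using hF)
  exact ⟨h 0, h 1⟩

theorem sect_three_of_dissection {F A B D : PowerSeries R}
    (hF : F = expand 3 three_ne_zero A + X * expand 3 three_ne_zero B +
      X ^ 2 * expand 3 three_ne_zero D) :
    sect 3 0 F = A ∧ sect 3 1 F = B ∧ sect 3 2 F = D := by
  have h := sect_of_dissection (m := 3) (A := ![A, B, D]) (by simpa [Fin.sum_univ_three] using hF)
  exact ⟨h 0, h 1, h 2⟩

theorem sect_two_one_expand (F : PowerSeries R) : sect 2 1 (expand 2 two_ne_zero F) = 0 :=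
  (sect_two_of_dissection (A := F) (B := 0) (by simp)).2

end Sections

section ExpandTheta

variable (m k : ℕ) [NeZero m] [NeZero k]

theorem expand_phi : expand m (NeZero.ne m) (phi k) = phi (m * k) :=
  expand_theta _ _ _ (by have := NeZero.pos k; omega)

theorem expand_phiNeg : expand m (NeZero.ne m) (phiNeg k) = phiNeg (m * k) :=
  expand_theta _ _ _ (by have := NeZero.pos k; omega)

theorem expand_psi : expand m (NeZero.ne m) (psi k) = psi (m * k) := by
  rw [psi, psi, expand_theta _ _ _ (by have := NeZero.pos k; omega), mul_left_comm]

theorem expand_pent : expand m (NeZero.ne m) (pent k) = pent (m * k) := by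
  rw [pent, pent, expand_theta _ _ _ (by have := NeZero.pos k; omega), mul_left_comm]

theorem expand_omegaNeg : expand m (NeZero.ne m) (omegaNeg k) = omegaNeg (m * k) := by
  rw [omegaNeg, omegaNeg, expand_theta _ _ _ (by have := NeZero.pos k; omega), mul_left_comm]

theorem expand_euler : expand m (NeZero.ne m) (euler k) = euler (m * k) := expand_qProd _ _ _ _ _

end ExpandTheta

section FourTwo

theorem constantCoeff_phiNeg (k : ℕ) [NeZero k] : constantCoeff (phiNeg k) = 1 := by
  have h := congrArg constantCoeff (phiNeg_mul_euler k)
  simpa [constantCoeff_euler] using h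

theorem isUnit_of_constantCoeff_eq_one {R : Type*} [CommRing R] {F : PowerSeries R}
    (h : constantCoeff F = 1) : IsUnit F := by
  simp [PowerSeries.isUnit_iff_constantCoeff, h]

theorem isUnit_phiNeg (k : ℕ) [NeZero k] : IsUnit (phiNeg k) :=
  isUnit_of_constantCoeff_eq_one (constantCoeff_phiNeg k)

theorem sect_two_zero_phi_mul_phiNeg :
    sect 2 0 (phi 1 * phiNeg 3) = phi 2 * phi 6 - 4 * X ^ 2 * psi 4 * psi 12 := by
  refine (sect_two_of_dissection (B := 2 * psi 4 * phi 6 - 2 * X * psi 12 * phi 2) ?_).1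
  simp only [map_mul, map_sub, map_pow, map_ofNat, expand_X, expand_phi, expand_psi,
    phi_two_dissection 1, phiNeg_two_dissection 3, Nat.reduceMul]
  ring

theorem sect_two_one_phi_mul_phi : sect 2 1 (phi 1 * phi 3) = 2 * psi 1 * psi 3 := by
  have odd_part := phi_mul_phi_sub_phiNeg_mul_phiNeg 1
  refine (sect_two_of_dissection (A := phi 2 * phi 6 + 4 * X ^ 2 * psi 4 * psi 12) ?_).2
  simp only [map_mul, map_add, map_pow, map_ofNat, expand_X, expand_phi, expand_psi,
    phi_two_dissection 1, phi_two_dissection 3, phiNeg_two_dissection 1, phiNeg_two_dissection 3,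
    Nat.reduceMul] at odd_part ⊢
  refine mul_left_cancel₀ (two_ne_zero (α := PowerSeries ℤ)) ?_
  linear_combination odd_part

theorem phiNeg_two_mul_phiNeg_six :
    phiNeg 2 * phiNeg 6 = expand 2 two_ne_zero (phiNeg 1 * phiNeg 3) := by
  simp only [map_mul, expand_phiNeg, Nat.reduceMul]

theorem phiNeg_mul_phiNeg_mul_sect_two_zero :
    phiNeg 2 * phiNeg 6 * sect 2 0 (schurOverGenFun 3) = phi 1 * phi 3 := by
  have even_part : phiNeg 1 * phiNeg 3 * sect 2 0 (schurOverGenFun 3) = phiNeg 2 * phiNeg 6 := by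
    rw [← sect_expand_mul two_pos, ← phiNeg_two_mul_phiNeg_six,
      phiNeg_mul_phiNeg_mul_schurOverGenFun 3, sect_two_zero_phi_mul_phiNeg]
    linear_combination phi_mul_phi_sub_phiNeg_mul_phiNeg 2
  refine mul_right_cancel₀ ((isUnit_phiNeg 1).mul (isUnit_phiNeg 3)).ne_zero ?_
  linear_combination phiNeg 2 * phiNeg 6 * even_part - phi 3 * phiNeg 3 * phi_mul_phiNeg 1 -
    phiNeg 2 ^ 2 * phi_mul_phiNeg 3

/-- The generating function of `S(4n + 2)`. -/
noncomputable def schurFourTwo : PowerSeries ℤ := sect 2 1 (sect 2 0 (schurOverGenFun 3))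

theorem coeff_schurFourTwo (n : ℕ) : coeff n schurFourTwo = schurOver 3 (4 * n + 2) := by
  rw [schurFourTwo, coeff_sect, coeff_sect, schurOver, show 2 * (2 * n + 1) + 0 = 4 * n + 2 by ring]

theorem phiNeg_mul_phiNeg_mul_schurFourTwo :
    phiNeg 1 * phiNeg 3 * schurFourTwo = 2 * psi 1 * psi 3 := by
  rw [schurFourTwo, ← sect_expand_mul one_lt_two, ← phiNeg_two_mul_phiNeg_six,
    phiNeg_mul_phiNeg_mul_sect_two_zero, sect_two_one_phi_mul_phi]

end FourTwo

section Twelve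

/-- The cubic norm `∏ φ(-ωq)` over the cube roots of unity `ω`, as a series in `q³`. -/
noncomputable def phiNegNorm : PowerSeries ℤ := phiNeg 3 ^ 3 - 8 * X * omegaNeg 1 ^ 3

theorem constantCoeff_phiNegNorm : constantCoeff phiNegNorm = 1 := by
  simp [phiNegNorm, constantCoeff_phiNeg]

theorem expand_phiNegNorm : expand 3 three_ne_zero phiNegNorm = phiNeg 1 *
    (phiNeg 9 ^ 2 + 2 * X * phiNeg 9 * omegaNeg 3 + 4 * X ^ 2 * omegaNeg 3 ^ 2) := by
  simp only [phiNegNorm, map_mul, map_sub, map_pow, map_ofNat, expand_X, expand_phiNeg,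
    expand_omegaNeg, phiNeg_three_dissection 1, Nat.reduceMul]
  ring

theorem expand_phiNegNorm_mul_schurFourTwo :
    expand 3 three_ne_zero (phiNegNorm * phiNeg 1) * schurFourTwo =
      expand 3 three_ne_zero
        (2 * psi 1 * (pent 1 * phiNeg 3 ^ 2 + 4 * X * psi 3 * omegaNeg 1 ^ 2)) +
      X * expand 3 three_ne_zero (6 * psi 1 * psi 3 * phiNeg 3 ^ 2) +
      X ^ 2 * expand 3 three_ne_zero (12 * (psi 1 * psi 3 * phiNeg 3 * omegaNeg 1)) := by
  have h := phiNeg_mul_phiNeg_mul_schurFourTwo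
  rw [psi_three_dissection 1] at h
  simp only [map_mul, map_add, map_pow, map_ofNat, expand_X, expand_phiNeg, expand_psi, expand_pent,
    expand_omegaNeg, expand_phiNegNorm, Nat.reduceMul] at h ⊢
  linear_combination
    (phiNeg 9 ^ 2 + 2 * X * phiNeg 9 * omegaNeg 3 + 4 * X ^ 2 * omegaNeg 3 ^ 2) * h +
    2 * psi 3 * (2 * X * phiNeg 9 + 4 * X ^ 2 * omegaNeg 3) * pent_mul_omegaNeg 3

theorem phiNegNorm_mul_phiNeg_mul_sect_three :
    phiNegNorm * phiNeg 1 * sect 3 1 schurFourTwo = 6 * psi 1 * psi 3 * phiNeg 3 ^ 2 ∧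
    phiNegNorm * phiNeg 1 * sect 3 2 schurFourTwo = 12 * (euler 2 * euler 6 ^ 3) := by
  have h := sect_three_of_dissection expand_phiNegNorm_mul_schurFourTwo
  rw [sect_expand_mul (m := 3) (by decide), sect_expand_mul (m := 3) (by decide),
    sect_expand_mul (m := 3) (by decide)] at h
  rw [h.2.1, h.2.2, ← psi_mul_psi_mul_phiNeg_mul_omegaNeg 1]
  exact ⟨rfl, rfl⟩

/-- The generating function of `S(12n + 6) / 3`. -/
noncomputable def schurTwelveSix : PowerSeries ℤ :=
  2 * psi 1 * psi 3 * phiNeg 3 ^ 2 * invOfUnit (phiNegNorm * phiNeg 1) 1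

/-- The generating function of `S(12n + 10) / 12`. -/
noncomputable def schurTwelveTen : PowerSeries ℤ :=
  euler 2 * euler 6 ^ 3 * invOfUnit (phiNegNorm * phiNeg 1) 1

theorem phiNegNorm_mul_phiNeg_mul_invOfUnit :
    phiNegNorm * phiNeg 1 * invOfUnit (phiNegNorm * phiNeg 1) 1 = 1 :=
  mul_invOfUnit _ _ (by simp [constantCoeff_phiNegNorm, constantCoeff_phiNeg])

theorem phiNegNorm_mul_phiNeg_mul_schurTwelveSix :
    phiNegNorm * phiNeg 1 * schurTwelveSix = 2 * psi 1 * psi 3 * phiNeg 3 ^ 2 := by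
  rw [schurTwelveSix, mul_left_comm, phiNegNorm_mul_phiNeg_mul_invOfUnit, mul_one]

theorem phiNegNorm_mul_phiNeg_mul_schurTwelveTen :
    phiNegNorm * phiNeg 1 * schurTwelveTen = euler 2 * euler 6 ^ 3 := by
  rw [schurTwelveTen, mul_left_comm, phiNegNorm_mul_phiNeg_mul_invOfUnit, mul_one]

theorem phiNegNorm_mul_phiNeg_ne_zero : phiNegNorm * phiNeg 1 ≠ 0 :=
  left_ne_zero_of_mul_eq_one phiNegNorm_mul_phiNeg_mul_invOfUnit

theorem coeff_ofNat_mul {R : Type*} [CommRing R] (c n : ℕ) [c.AtLeastTwo] (F : PowerSeries R) :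
    coeff n (OfNat.ofNat c * F) = OfNat.ofNat c * coeff n F := by
  rw [← map_ofNat C, coeff_C_mul]

theorem schurOver_twelve_mul_add_six (n : ℕ) :
    schurOver 3 (12 * n + 6) = 3 * coeff n schurTwelveSix := by
  have h : sect 3 1 schurFourTwo = 3 * schurTwelveSix := by
    refine mul_left_cancel₀ phiNegNorm_mul_phiNeg_ne_zero ?_
    linear_combination phiNegNorm_mul_phiNeg_mul_sect_three.1 -
      3 * phiNegNorm_mul_phiNeg_mul_schurTwelveSix
  rw [← coeff_ofNat_mul, ← h, coeff_sect, coeff_schurFourTwo]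
  ring_nf

theorem schurOver_twelve_mul_add_ten (n : ℕ) :
    schurOver 3 (12 * n + 10) = 12 * coeff n schurTwelveTen := by
  have h : sect 3 2 schurFourTwo = 12 * schurTwelveTen := by
    refine mul_left_cancel₀ phiNegNorm_mul_phiNeg_ne_zero ?_
    linear_combination phiNegNorm_mul_phiNeg_mul_sect_three.2 -
      12 * phiNegNorm_mul_phiNeg_mul_schurTwelveTen
  rw [← coeff_ofNat_mul, ← h, coeff_sect, coeff_schurFourTwo]
  ring_nf

end Twelve

section Reduction

/-- Reduction of the coefficients of an integral power series modulo `m`. -/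
noncomputable def red (m : ℕ) : PowerSeries ℤ →+* PowerSeries (ZMod m) :=
  PowerSeries.map (Int.castRingHom (ZMod m))

theorem red_eq_red_iff {m : ℕ} {F G : PowerSeries ℤ} :
    red m F = red m G ↔ ∀ n, coeff n F ≡ coeff n G [ZMOD m] := by
  simp [red, PowerSeries.ext_iff, ZMod.intCast_eq_intCast_iff]

theorem red_natCast_mul_eq {m : ℕ} {F G : PowerSeries ℤ} (c : ℕ) (h : red m F = red m G) :
    red (c * m) (c * F) = red (c * m) (c * G) := by
  rw [red_eq_red_iff] at h ⊢
  intro n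
  rw [← map_natCast C, coeff_C_mul, coeff_C_mul, Nat.cast_mul]
  exact (h n).mul_left'

theorem red_sect_eq {m : ℕ} {F G : PowerSeries ℤ} (h : red m F = red m G) (d r : ℕ) :
    red m (sect d r F) = red m (sect d r G) := by
  rw [red, map_sect, map_sect]
  exact congrArg (sect d r) h

theorem red_pow_prime (p : ℕ) [hp : Fact p.Prime] (F : PowerSeries ℤ) :
    red p (F ^ p) = red p (expand p hp.out.ne_zero F) := by
  have h := MvPowerSeries.map_frobenius_expand p hp.out.ne_zero (f := red p F)
  rw [ZMod.frobenius_zmod, MvPowerSeries.map_id] at h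
  rw [map_pow, red, map_expand]
  exact h.symm

theorem natCast_powerSeries_zmod_self (m : ℕ) : (m : PowerSeries (ZMod m)) = 0 := by
  rw [← map_natCast C, ZMod.natCast_self, map_zero]

theorem two_eq_zero : (2 : PowerSeries (ZMod 2)) = 0 := natCast_powerSeries_zmod_self 2

theorem three_eq_zero : (3 : PowerSeries (ZMod 3)) = 0 := natCast_powerSeries_zmod_self 3

theorem four_eq_zero : (4 : PowerSeries (ZMod 4)) = 0 := natCast_powerSeries_zmod_self 4

end Reduction

section ModThree

theorem red_three_phiNegNorm : red 3 phiNegNorm = red 3 (phiNeg 1) := by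
  have frobenius_phiNeg := red_pow_prime 3 (phiNeg 3)
  have frobenius_omegaNeg := red_pow_prime 3 (omegaNeg 1)
  rw [expand_phiNeg] at frobenius_phiNeg
  rw [expand_omegaNeg] at frobenius_omegaNeg
  simp only [phiNegNorm, phiNeg_three_dissection 1, map_sub, map_mul, map_pow, map_ofNat,
    Nat.reduceMul] at frobenius_phiNeg frobenius_omegaNeg ⊢
  linear_combination frobenius_phiNeg - 8 * red 3 X * frobenius_omegaNeg -
    2 * red 3 X * red 3 (omegaNeg 3) * three_eq_zero

theorem red_three_schurTwelveSix :
    red 3 schurTwelveSix = red 3 (2 * (psi 1 * phiNeg 1 * (psi 3 * phiNeg 3))) := by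
  have h := congrArg (red 3) phiNegNorm_mul_phiNeg_mul_schurTwelveSix
  have frobenius := red_pow_prime 3 (phiNeg 1)
  rw [expand_phiNeg] at frobenius
  refine ((isUnit_phiNeg 3).map (red 3)).mul_left_cancel ?_
  simp only [map_mul, map_pow, map_ofNat, red_three_phiNegNorm, Nat.reduceMul] at h frobenius ⊢
  linear_combination red 3 (phiNeg 1) * h - red 3 schurTwelveSix * frobenius

/-- Equivalently, `η(2τ)η(4τ)η(6τ)η(12τ)` has Hecke eigenvalue `-1` at `3`. -/
theorem sect_three_one_psi_mul_phiNeg :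
    sect 3 1 (psi 1 * phiNeg 1 * (psi 3 * phiNeg 3)) =
      -(psi 1 * phiNeg 1 * (psi 3 * phiNeg 3)) := by
  have h : sect 3 1 (psi 1 * phiNeg 1) = -(psi 3 * phiNeg 3) := by
    refine (sect_three_of_dissection (A := pent 1 * phiNeg 3) (D := -(2 * psi 3 * omegaNeg 1))
      ?_).2.1
    simp only [map_mul, map_neg, map_ofNat, expand_phiNeg, expand_psi, expand_pent, expand_omegaNeg,
      psi_three_dissection 1, phiNeg_three_dissection 1, Nat.reduceMul]
    linear_combination (-2 * X) * pent_mul_omegaNeg 3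
  have h_three : psi 3 * phiNeg 3 = expand 3 three_ne_zero (psi 1 * phiNeg 1) := by
    simp only [map_mul, expand_phiNeg, expand_psi, Nat.reduceMul]
  rw [mul_comm, h_three, sect_expand_mul (m := 3) (by decide), h, ← h_three]
  ring

theorem red_three_sect_schurTwelveSix :
    red 3 (sect 3 1 schurTwelveSix) = red 3 (-schurTwelveSix) := by
  rw [red_sect_eq red_three_schurTwelveSix, two_mul, map_add, sect_three_one_psi_mul_phiNeg,
    map_neg, red_three_schurTwelveSix]
  simp only [map_add, map_neg, map_mul, map_ofNat]
  ring

theorem three_dvd_schurOver (n : ℕ) : 3 ∣ schurOver 3 (12 * n + 6) :=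
  ⟨_, schurOver_twelve_mul_add_six n⟩

theorem schurOver_three_mul_modEq_nine (n : ℕ) :
    schurOver 3 (3 * (12 * n + 6)) ≡ -schurOver 3 (12 * n + 6) [ZMOD 9] := by
  have h := red_eq_red_iff.mp red_three_sect_schurTwelveSix n
  rw [show 3 * (12 * n + 6) = 12 * (3 * n + 1) + 6 by ring, schurOver_twelve_mul_add_six,
    schurOver_twelve_mul_add_six, ← mul_neg]
  rw [coeff_sect, map_neg] at h
  exact h.mul_left'

theorem exists_three_pow_mul_eq (a n : ℕ) : ∃ m, 3 ^ a * (12 * n + 6) = 12 * m + 6 := by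
  induction a with
  | zero => exact ⟨n, by simp⟩
  | succ a ih =>
    obtain ⟨m, hm⟩ := ih
    exact ⟨3 * m + 1, by rw [pow_succ', mul_assoc, hm]; ring⟩

theorem schurOver_three_pow_mul_modEq_nine (a n : ℕ) :
    schurOver 3 (3 ^ a * (12 * n + 6)) ≡ (-1) ^ a * schurOver 3 (12 * n + 6) [ZMOD 9] := by
  induction a with
  | zero => simp [Int.ModEq]
  | succ a ih =>
    obtain ⟨m, hm⟩ := exists_three_pow_mul_eq a n
    rw [pow_succ', pow_succ', mul_assoc, mul_assoc, neg_one_mul, hm]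
    rw [hm] at ih
    exact (schurOver_three_mul_modEq_nine m).trans ih.neg

end ModThree

section ModTwo

variable (k : ℕ) [NeZero k]

theorem red_two_phiNeg : red 2 (phiNeg k) = 1 := by
  have h := congrArg (red 2) (phiNeg_mul_euler k)
  rw [red_pow_prime, expand_euler, map_mul] at h
  have euler_unit := isUnit_of_constantCoeff_eq_one (constantCoeff_euler (2 * k))
  exact (euler_unit.map (red 2)).mul_eq_right.mp h

theorem phiNeg_add_eq_phi : phiNeg k + 4 * (X ^ k * psi (8 * k)) = phi k := by
  rw [phiNeg_two_dissection k, phi_two_dissection k]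
  ring

theorem red_four_phi : red 4 (phi k) = red 4 (phiNeg k) := by
  rw [← phiNeg_add_eq_phi, map_add, map_mul, map_ofNat, four_eq_zero, zero_mul, add_zero]

theorem red_two_phi : red 2 (phi k) = 1 := by
  rw [← phiNeg_add_eq_phi, map_add, map_mul, map_ofNat, red_two_phiNeg]
  linear_combination 2 * red 2 (X ^ k * psi (8 * k)) * two_eq_zero

theorem exists_eq_one_add_two_mul {F : PowerSeries ℤ} (h : red 2 F = 1) :
    ∃ G, F = 1 + 2 * G := by
  rw [← map_one (red 2), red_eq_red_iff] at h
  choose g hg using fun n => (h n).symm.dvd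
  refine ⟨mk g, PowerSeries.ext fun n => ?_⟩
  rw [map_add, coeff_ofNat_mul, coeff_mk]
  linear_combination hg n

theorem red_four_mul {F G : PowerSeries ℤ} (hF : red 2 F = 1) (hG : red 2 G = 1) :
    red 4 (F * G) = red 4 (F + G - 1) := by
  obtain ⟨F, rfl⟩ := exists_eq_one_add_two_mul hF
  obtain ⟨G, rfl⟩ := exists_eq_one_add_two_mul hG
  simp only [map_add, map_sub, map_mul, map_one, map_ofNat]
  linear_combination red 4 F * red 4 G * four_eq_zero

theorem red_four_phi_mul_self : red 4 (phi k) * red 4 (phi k) = 1 := by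
  have h := red_natCast_mul_eq 2 ((red_two_phi k).trans (map_one (red 2)).symm)
  simp only [Nat.reduceMul, map_mul, Nat.cast_ofNat, map_ofNat, map_one] at h
  rw [← map_mul, red_four_mul (red_two_phi k) (red_two_phi k)]
  simp only [map_add, map_sub, map_one]
  linear_combination h

end ModTwo

section ModSixteen

theorem euler_two_mul_euler_six_pow :
    euler 2 * euler 6 ^ 3 = expand 2 two_ne_zero (euler 1 * euler 3 ^ 3) := by
  simp only [map_mul, map_pow, expand_euler, Nat.reduceMul]

theorem red_two_schurTwelveTen : red 2 schurTwelveTen = red 2 (euler 2 * euler 6 ^ 3) := by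
  rw [← phiNegNorm_mul_phiNeg_mul_schurTwelveTen, phiNegNorm]
  simp only [map_mul, map_sub, map_pow, map_ofNat, red_two_phiNeg]
  linear_combination 4 * red 2 X * red 2 (omegaNeg 1) ^ 3 * red 2 schurTwelveTen * two_eq_zero

theorem twentyFour_dvd_schurOver (n : ℕ) : 24 ∣ schurOver 3 (24 * n + 22) := by
  have h := red_eq_red_iff.mp (red_sect_eq red_two_schurTwelveTen 2 1) n
  rw [euler_two_mul_euler_six_pow, sect_two_one_expand, coeff_sect, map_zero] at h
  rw [show 24 * n + 22 = 12 * (2 * n + 1) + 10 by ring, schurOver_twelve_mul_add_ten]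
  exact mul_dvd_mul_left 12 (Int.modEq_zero_iff_dvd.mp h)

theorem red_four_schurTwelveTen :
    red 4 schurTwelveTen = red 4 (euler 2 * euler 6 ^ 3 * (phi 1 * phi 3)) := by
  rw [← phiNegNorm_mul_phiNeg_mul_schurTwelveTen, phiNegNorm]
  simp only [map_mul, map_sub, map_pow, map_ofNat, ← red_four_phi]
  linear_combination
    -red 4 schurTwelveTen * red 4 (phi 3) ^ 4 * red_four_phi_mul_self 1 -
    red 4 schurTwelveTen * (red 4 (phi 3) ^ 2 + 1) * red_four_phi_mul_self 3 +
    2 * red 4 X * red 4 (omegaNeg 1) ^ 3 * red 4 (phi 1) ^ 2 * red 4 (phi 3) *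
      red 4 schurTwelveTen * four_eq_zero

theorem red_four_sect_schurTwelveTen : red 4 (sect 2 1 schurTwelveTen) =
    red 4 (expand 2 two_ne_zero (2 * (euler 1 ^ 2 * euler 3 ^ 3))) := by
  have frobenius := red_natCast_mul_eq 2 (red_pow_prime 2 (euler 3))
  rw [red_sect_eq red_four_schurTwelveTen, euler_two_mul_euler_six_pow,
    sect_expand_mul one_lt_two, sect_two_one_phi_mul_phi]
  have reorder : euler 1 * euler 3 ^ 3 * (2 * psi 1 * psi 3) =
      euler 2 ^ 2 * euler 6 ^ 2 * (2 * euler 3 ^ 2) := by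
    linear_combination 2 * euler 3 ^ 3 * psi 3 * psi_mul_euler 1 +
      2 * euler 2 ^ 2 * euler 3 ^ 2 * psi_mul_euler 3
  rw [reorder]
  simp only [map_mul, map_pow, map_ofNat, expand_euler, Nat.reduceMul, Nat.cast_ofNat]
    at frobenius ⊢
  linear_combination red 4 (euler 2) ^ 2 * red 4 (euler 6) ^ 2 * frobenius

theorem fortyEight_dvd_schurOver (n : ℕ) : 48 ∣ schurOver 3 (48 * n + 46) := by
  have h := red_eq_red_iff.mp (red_sect_eq red_four_sect_schurTwelveTen 2 1) n
  rw [sect_two_one_expand, coeff_sect, coeff_sect, map_zero] at h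
  rw [show 48 * n + 46 = 12 * (2 * (2 * n + 1) + 1) + 10 by ring, schurOver_twelve_mul_add_ten]
  exact mul_dvd_mul_left 12 (Int.modEq_zero_iff_dvd.mp h)

end ModSixteen

section ModFour

theorem hasSum_coeff_phi (k n : ℕ) [NeZero k] :
    HasSum (fun j : ℤ => if n = k * j.natAbs ^ 2 then (1 : ℤ) else 0) (coeff n (phi k)) := by
  have h := (WithPiTopology.hasSum_iff_hasSum_coeff ℤ).mp
    (hasSum_theta 1 (u := k) (v := k) (by have := NeZero.pos k; omega)) n
  simp only [← mul_add, triangular_add_triangular_neg, one_zpow, Units.val_one,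
    coeff_monomial] at h
  exact h

theorem coeff_phi_eq_zero {k n : ℕ} [NeZero k] (h : ∀ j, n ≠ k * j ^ 2) : coeff n (phi k) = 0 := by
  refine (hasSum_coeff_phi k n).unique ?_
  simpa only [if_neg (h _)] using hasSum_zero

theorem sect_zero_phi_mul (m k : ℕ) [NeZero m] [NeZero k] : sect m 0 (phi (m * k)) = phi k := by
  rw [← expand_phi, sect_zero_expand]

theorem sect_zero_phi {p : ℕ} (hp : p.Prime) {k : ℕ} [NeZero k] [NeZero p] (hk : ¬ p ∣ k) :
    sect p 0 (phi k) = phi (p * k) := by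
  ext n
  rw [coeff_sect, add_zero]
  have inj : Function.Injective fun j : ℤ => (p : ℤ) * j :=
    mul_right_injective₀ (mod_cast hp.ne_zero)
  refine (hasSum_coeff_phi k (p * n)).unique ((inj.hasSum_iff fun i hi => if_neg fun h => ?_).mp
    ?_)
  · have dvd : p ∣ i.natAbs :=
      hp.dvd_of_dvd_pow ((hp.dvd_mul.mp ⟨n, h.symm⟩).resolve_left hk)
    obtain ⟨j, hj⟩ := Int.natCast_dvd.mpr dvd
    exact hi ⟨j, hj.symm⟩
  · convert hasSum_coeff_phi (p * k) n using 2 with j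
    refine if_congr ?_ rfl rfl
    rw [Int.natAbs_mul, Int.natAbs_natCast, ← Nat.mul_right_inj hp.ne_zero (b := n)]
    ring_nf

variable (t : ℕ) [NeZero t]

/-- The theta series counting representations by `m²`, `2m²`, `tm²` and `2tm²` with `m ∈ ℤ`,
normalized to have constant coefficient `1`. -/
noncomputable def squareSum (t : ℕ) : PowerSeries ℤ := phi 1 + phi 2 + phi t + phi (2 * t) - 3

theorem red_four_schurOverGenFun : red 4 (schurOverGenFun t) = red 4 (squareSum t) := by
  have product : red 4 (phi 1 * phi 2 * (phi t * phi (2 * t))) = red 4 (squareSum t) := by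
    have sq_pair := red_four_mul (red_two_phi 1) (red_two_phi 2)
    have t_pair := red_four_mul (red_two_phi t) (red_two_phi (2 * t))
    rw [red_four_mul (by rw [map_mul, red_two_phi, red_two_phi, one_mul])
      (by rw [map_mul, red_two_phi, red_two_phi, one_mul]), map_sub, map_add, sq_pair, t_pair,
      squareSum]
    simp only [map_add, map_sub, map_one, map_ofNat]
    ring
  have quotient := congrArg (red 4) (phiNeg_mul_phiNeg_mul_schurOverGenFun t)
  rw [← product]
  simp only [map_mul, ← red_four_phi] at quotient ⊢
  linear_combination red 4 (phi 2) * red 4 (phi (2 * t)) * quotient -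
    red 4 (schurOverGenFun t) * red_four_phi_mul_self 2 -
    red 4 (schurOverGenFun t) * red 4 (phi 2) ^ 2 * red_four_phi_mul_self (2 * t)

theorem schurOver_modEq_coeff_squareSum (n : ℕ) :
    schurOver t n ≡ coeff n (squareSum t) [ZMOD 4] :=
  red_eq_red_iff.mp (red_four_schurOverGenFun t) n

variable {t}

theorem sect_two_zero_squareSum (ht : ¬ 2 ∣ t) : sect 2 0 (squareSum t) = squareSum t := by
  have h_one := sect_zero_phi Nat.prime_two (k := 1) (by decide)
  have h_two := sect_zero_phi_mul 2 1
  rw [mul_one] at h_one h_two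
  simp only [squareSum, map_sub, map_add, sect_zero_ofNat 2 3, h_one, h_two,
    sect_zero_phi Nat.prime_two ht, sect_zero_phi_mul]
  ring

theorem sect_prime_zero_squareSum (ht : t.Prime) (ht' : t ≠ 2) :
    sect t 0 (squareSum t) = squareSum t := by
  have not_dvd_two : ¬ t ∣ 2 := fun h => ht' ((Nat.prime_dvd_prime_iff_eq ht Nat.prime_two).mp h)
  have h_t := sect_zero_phi_mul t 1
  rw [mul_one] at h_t
  simp only [squareSum, map_sub, map_add, sect_zero_ofNat t 3, h_t, sect_zero_phi ht not_dvd_two,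
    sect_zero_phi ht ht.not_dvd_one, mul_comm 2 t, sect_zero_phi_mul, mul_one]
  ring

theorem schurOver_pow_mul_modEq {p : ℕ} (h : sect p 0 (squareSum t) = squareSum t) (a n : ℕ) :
    schurOver t (p ^ a * n) ≡ schurOver t n [ZMOD 4] := by
  induction a with
  | zero => simp [Int.ModEq]
  | succ a ih =>
    refine Int.ModEq.trans ?_ ih
    have coeff_eq := congrArg (coeff (p ^ a * n)) h
    rw [coeff_sect, add_zero] at coeff_eq
    rw [pow_succ', mul_assoc]
    refine (schurOver_modEq_coeff_squareSum t _).trans ?_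
    rw [coeff_eq]
    exact (schurOver_modEq_coeff_squareSum t _).symm

theorem schurOver_two_pow_mul_modEq (ht : ¬ 2 ∣ t) (a n : ℕ) :
    schurOver t (2 ^ a * n) ≡ schurOver t n [ZMOD 4] :=
  schurOver_pow_mul_modEq (sect_two_zero_squareSum ht) a n

theorem schurOver_prime_pow_mul_modEq (ht : t.Prime) (ht' : t ≠ 2) (a n : ℕ) :
    schurOver t (t ^ a * n) ≡ schurOver t n [ZMOD 4] :=
  schurOver_pow_mul_modEq (sect_prime_zero_squareSum ht ht') a n

theorem four_dvd_schurOver {n : ℕ} (h : n % 8 = 5 ∨ n % 8 = 7 ∨ n % 8 = 3 ∧ n % 3 ≠ 0) :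
    4 ∣ schurOver 3 n := by
  have square_mod_eight (j : ℕ) : j ^ 2 % 8 = 0 ∨ j ^ 2 % 8 = 1 ∨ j ^ 2 % 8 = 4 := by
    have : j % 8 < 8 := Nat.mod_lt _ (by decide)
    rw [Nat.pow_mod]
    interval_cases j % 8 <;> simp
  have vanish (k : ℕ) [NeZero k] (hk : k = 1 ∨ k = 2 ∨ k = 3 ∨ k = 6) : coeff n (phi k) = 0 := by
    refine coeff_phi_eq_zero fun j => ?_
    have := square_mod_eight j
    rcases hk with rfl | rfl | rfl | rfl <;> omega
  have modEq := schurOver_modEq_coeff_squareSum 3 n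
  rw [squareSum, map_sub, map_add, map_add, map_add, vanish 1 (by decide), vanish 2 (by decide),
    vanish 3 (by decide), vanish (2 * 3) (by decide), ← map_ofNat C, coeff_C,
    if_neg (by omega)] at modEq
  exact Int.modEq_zero_iff_dvd.mp modEq

end ModFour

section Congruences

theorem four_dvd_schurOver_two_pow_mul {n : ℕ}
    (h : n % 8 = 5 ∨ n % 8 = 7 ∨ n % 8 = 3 ∧ n % 3 ≠ 0) (a : ℕ) :
    4 ∣ schurOver 3 (2 ^ a * n) :=
  (schurOver_two_pow_mul_modEq (by decide) a n).dvd_iff.mpr (four_dvd_schurOver h)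

theorem four_dvd_schurOver_two_mul_three_mul {n : ℕ}
    (h : n % 8 = 5 ∨ n % 8 = 7 ∨ n % 8 = 3 ∧ n % 3 ≠ 0) : 4 ∣ schurOver 3 (2 * (3 * n)) := by
  have two := schurOver_two_pow_mul_modEq (t := 3) (by decide) 1 (3 * n)
  have three := schurOver_prime_pow_mul_modEq Nat.prime_three (by decide) 1 n
  rw [pow_one] at two three
  exact (two.trans three).dvd_iff.mpr (four_dvd_schurOver h)

theorem twelve_dvd_schurOver {n k : ℕ} (hk : 3 * n = 6 * k + 3)
    (h : n % 8 = 5 ∨ n % 8 = 7 ∨ n % 8 = 3 ∧ n % 3 ≠ 0) : 12 ∣ schurOver 3 (12 * k + 6) := by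
  have four := four_dvd_schurOver_two_mul_three_mul h
  rw [show 2 * (3 * n) = 12 * k + 6 by omega] at four
  have three := three_dvd_schurOver k
  omega

theorem schurOver_three_pow_mul_modEq_twelve (a n : ℕ) :
    schurOver 3 (3 ^ a * (12 * n + 6)) ≡ schurOver 3 (12 * n + 6) [ZMOD 12] := by
  have mod_four := (schurOver_prime_pow_mul_modEq Nat.prime_three (by decide) a (12 * n + 6)).dvd
  have three := three_dvd_schurOver n
  obtain ⟨m, hm⟩ := exists_three_pow_mul_eq a n
  have three' := three_dvd_schurOver m
  rw [← hm] at three'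
  exact Int.modEq_iff_dvd.mpr (by omega)

end Congruences

theorem theorem4p3_general (n α : ℕ) :
    schurOver 3 (2 ^ α * n) ≡ schurOver 3 n [ZMOD 4] ∧
    schurOver 3 (3 ^ α * n) ≡ schurOver 3 n [ZMOD 4] ∧
    schurOver 3 (32 * n + 20) ≡ 0 [ZMOD 4] ∧
    (∀ j ∈ Finset.Icc 1 5, schurOver 3 (96 * n + 16 * j + 12) ≡ 0 [ZMOD 4]) ∧
    schurOver 3 (3 ^ α * (12 * n + 6)) ≡ (-1) ^ α * schurOver 3 (12 * n + 6) [ZMOD 9] ∧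
    schurOver 3 (3 ^ α * (12 * n + 6)) ≡ schurOver 3 (12 * n + 6) [ZMOD 12] ∧
    (∀ i ∈ Finset.Icc 1 5, schurOver 3 (144 * n + 24 * i + 18) ≡ 0 [ZMOD 12]) ∧
    schurOver 3 (48 * n + 30) ≡ 0 [ZMOD 12] ∧
    schurOver 3 (48 * n + 42) ≡ 0 [ZMOD 12] ∧
    schurOver 3 (48 * n + 46) ≡ 0 [ZMOD 16] ∧
    schurOver 3 (24 * n + 22) ≡ 0 [ZMOD 24] := by
  refine ⟨schurOver_two_pow_mul_modEq (by decide) α n,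
    schurOver_prime_pow_mul_modEq Nat.prime_three (by decide) α n, ?_, fun j hj => ?_,
    schurOver_three_pow_mul_modEq_nine α n, schurOver_three_pow_mul_modEq_twelve α n,
    fun i hi => ?_, ?_, ?_,
    ((by decide : (16 : ℤ) ∣ 48).trans (fortyEight_dvd_schurOver n)).modEq_zero_int,
    (twentyFour_dvd_schurOver n).modEq_zero_int⟩ <;> refine Dvd.dvd.modEq_zero_int ?_
  · rw [show 32 * n + 20 = 2 ^ 2 * (8 * n + 5) by ring]
    exact four_dvd_schurOver_two_pow_mul (by omega) 2
  · rw [Finset.mem_Icc] at hj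
    rw [show 96 * n + 16 * j + 12 = 2 ^ 2 * (24 * n + 4 * j + 3) by ring]
    exact four_dvd_schurOver_two_pow_mul (by omega) 2
  · rw [Finset.mem_Icc] at hi
    rw [show 144 * n + 24 * i + 18 = 12 * (12 * n + 2 * i + 1) + 6 by ring]
    exact twelve_dvd_schurOver (n := 24 * n + 4 * i + 3) (by ring) (by omega)
  · rw [show 48 * n + 30 = 12 * (4 * n + 2) + 6 by ring]
    exact twelve_dvd_schurOver (n := 8 * n + 5) (by ring) (by omega)
  · rw [show 48 * n + 42 = 12 * (4 * n + 3) + 6 by ring]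
    exact twelve_dvd_schurOver (n := 8 * n + 7) (by ring) (by omega)

theorem theorem4p3 (n α : ℕ) :
    schurOver 3 (2 ^ α * (2 * n)) ≡ schurOver 3 (2 * n) [ZMOD 4] ∧
    schurOver 3 (3 ^ α * (2 * n + 1)) ≡ schurOver 3 (2 * n + 1) [ZMOD 4] ∧
    schurOver 3 (32 * n + 20) ≡ 0 [ZMOD 4] ∧
    (∀ j ∈ Finset.Icc 1 5, schurOver 3 (96 * n + 16 * j + 12) ≡ 0 [ZMOD 4]) ∧
    schurOver 3 (3 ^ α * (12 * n + 6)) ≡ (-1) ^ α * schurOver 3 (12 * n + 6) [ZMOD 9] ∧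
    schurOver 3 (3 ^ α * (12 * n + 6)) ≡ schurOver 3 (12 * n + 6) [ZMOD 12] ∧
    (∀ i ∈ Finset.Icc 1 5, schurOver 3 (144 * n + 24 * i + 18) ≡ 0 [ZMOD 12]) ∧
    schurOver 3 (48 * n + 30) ≡ 0 [ZMOD 12] ∧
    schurOver 3 (48 * n + 42) ≡ 0 [ZMOD 12] ∧
    schurOver 3 (48 * n + 46) ≡ 0 [ZMOD 16] ∧
    schurOver 3 (24 * n + 22) ≡ 0 [ZMOD 24] :=
  ⟨(theorem4p3_general (2 * n) α).1, (theorem4p3_general (2 * n + 1) α).2.1,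
    (theorem4p3_general n α).2.2⟩
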